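/- \textbf{Theorem.} Let $N=(S,A,T)$ be a finite labelled P/T net with silent moves, i.e. $S$ and $A$ are finite, $\tau\in A$, and $T\subseteq(\mathcal M(S)\setminus\{\theta\})\times A\times\mathcal M(S)$ is finite, where $\mathcal M(S)$ is the set of finite multisets (markings) over $S$ and $\theta$ is the empty one. If $m_1\approx_d m_2$, then $m_1\approx_{bfc}m_2$. \emph{Notation.} A transition $t=({}^\bullet t,l(t),t^\bullet)$ is enabled at $m$ if ${}^\bullet t\subseteq m$, and then $m[t\rangle m'$ with $m'=(m\ominus{}^\bullet t)\oplus t^\bullet$; this extends to sequences. For sequences, ${}^\bullet\epsilon=\epsilon^\bullet=\theta$, ${}^\bullet(t\sigma)={}^\bullet t\oplus({}^\bullet\sigma\ominus t^\bullet)$, $(t\sigma)^\bullet=\sigma^\bullet\oplus(t^\bullet\ominus{}^\bullet\sigma)$, and $o(\sigma)$ is the sequence of the labels different from $\tau$. A transition $t$ is \emph{$\tau$-sequential} if $l(t)=\tau$ and $|{}^\bullet t|=|t^\bullet|=1$. A sequence $t_1\dots t_n$ ($n\ge1$) of $\tau$-sequential transitions taken from $T$ and from the fictitious idling transitions $(s,\tau,s)$,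 $s\in S$, is \emph{$\tau$-1-sequential} if $t_i^\bullet={}^\bullet t_{i+1}$ for all $i<n$. A sequence $\sigma$ is \emph{$\tau$-sequential} if $\sigma=\sigma_1\cdots\sigma_k$ for some $k\ge1$ with every $\sigma_i$ $\tau$-1-sequential, ${}^\bullet\sigma={}^\bullet\sigma_1\oplus\dots\oplus{}^\bullet\sigma_k$ and $\sigma^\bullet=\sigma_1^\bullet\oplus\dots\oplus\sigma_k^\bullet$. For such $\sigma=t_1\dots t_n$ with run ${}^\bullet\sigma=n_0[t_1\rangle n_1\cdots[t_n\rangle n_n=\sigma^\bullet$, and a relation $Q$ on markings, $\Psi(m,\sigma,Q)$ means $(m,n_i)\in Q$ for $0\le i<n$, and $\Phi(\sigma,m,Q)$ means $(n_i,m)\in Q$ for $0\le i<n$. \emph{Branching d-place bisimilarity.} For $R\subseteq(S\cup\{\theta\})\times(S\cup\{\theta\})$, let $R^\odot$ be the least relation on markings with $(\theta,\theta)\in R^\odot$ and $(r_1\oplus m_1,r_2\oplus m_2)\in R^\odot$ whenever $(r_1,r_2)\in R$ and $(m_1,m_2)\in R^\odot$. Let $\overline R=R\cap(S\times S)$ and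 let $\overline R^\oplus$ be its closure under the same two clauses. $R$ is a \emph{branching d-place bisimulation} if, whenever $(m_1,m_2)\in R^\odot$: \begin{enumerate} \item for all $t_1\in T$ with $m_1[t_1\rangle m_1'$, either (i) $t_1$ is $\tau$-sequential and there are a $\tau$-sequential $\sigma$ and $m_2'$ with $m_2[\sigma\rangle m_2'$, $\Psi({}^\bullet t_1,\sigma,\overline R^\oplus)$, $({}^\bullet t_1,\sigma^\bullet)\in\overline R^\oplus$, $(t_1^\bullet,\sigma^\bullet)\in\overline R^\oplus$ and $(m_1\ominus{}^\bullet t_1,m_2\ominus{}^\bullet\sigma)\in R^\odot$; or (ii) there are a $\tau$-sequential $\sigma$, $t_2\in T$ and $m,m_2'$ with $m_2[\sigma\rangle m[t_2\rangle m_2'$, $l(t_1)=l(t_2)$, $\sigma^\bullet={}^\bullet t_2$, $\Psi({}^\bullet t_1,\sigma,\overline R^\oplus)$, $({}^\bullet t_1,{}^\bullet t_2)\in\overline R^\oplus$, $(t_1^\bullet,t_2^\bullet)\in R^\odot$ and $(m_1\ominus{}^\bullet t_1,m_2\ominus{}^\bullet\sigma)\in R^\odot$; \item symmetrically for all $t_2\in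 T$ with $m_2[t_2\rangle m_2'$, with $\Phi(\sigma,{}^\bullet t_2,\overline R^\oplus)$ in place of $\Psi$. \end{enumerate} $m_1\approx_d m_2$ means that $(m_1,m_2)\in R^\odot$ for some branching d-place bisimulation $R$. \emph{Processes.} A \emph{causal net} $C=(B,A,E,\mathsf m_0)$ is a finite marked P/T net (places are called conditions, transitions events) whose flow relation is acyclic, in which each condition has at most one producing and at most one consuming event, whose initial marking $\mathsf m_0$ is the set of conditions without a producing event, and all of whose arcs have weight $1$. Put $Min(C)=\mathsf m_0$, and let $Max(C)$ be the set of conditions without a consuming event. Conditions are named by elements of a fixed, arbitrary infinite set. A \emph{process} of $N(m_0)$ is a pair $\pi=(C,\rho)$ with $C$ a causal net and $\rho$ a map sending conditions to places and events to transitions, preserving labels, pre-sets and post-sets (as multisets), with $\rho(\mathsf m_0)=m_0$. For causal nets, $C[e\rangle C'$ means that $C,C'$ have the same initial marking, ${}^\bullet e\subseteq Max(C)$, $E'=E\cup\{e\}$ and $B'=B\cup e^\bullet$. For processes of the same $N(m_0)$, $(C,\rho)\xrightarrow{e}(C',\rho')$ means $C[e\rangle C'$ and $\rho\subseteq\rho'$;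 $\pi\stackrel{\sigma}{\Rightarrow}\pi'$ is the extension to sequences. An \emph{abstract event isomorphism} between $C_1$ and $C_2$ is a label-preserving bijection between their events with label $\neq\tau$ that preserves and reflects the order ``there is a (possibly empty) flow path from $e$ to $e'$''. \emph{Branching fully-concurrent bisimilarity.} A \emph{branching fc-bisimulation} is a set $\mathcal R$ of triples $(\pi_1,g,\pi_2)$, with $\pi_i=(C_i,\rho_i)$ a process of $N(m_{0i})$ for some $m_{0i}$ and $g$ an abstract event isomorphism between $C_1$ and $C_2$, such that if $(\pi_1,g,\pi_2)\in\mathcal R$ and $\pi_1\xrightarrow{e_1}\pi_1'$ then \begin{itemize} \item either $l(e_1)=\tau$ and there are $\sigma_2$ with $o(\sigma_2)=\epsilon$ and $\pi_2'$ with $\pi_2\stackrel{\sigma_2}{\Rightarrow}\pi_2'$, $(\pi_1,g,\pi_2')\in\mathcal R$ and $(\pi_1',g,\pi_2')\in\mathcal R$; \item or there are $\sigma$ with $o(\sigma)=\epsilon$, $e_2,\pi_2',\pi_2'',g'$ with $\pi_2\stackrel{\sigma}{\Rightarrow}\pi_2'\xrightarrow{e_2}\pi_2''$, where $l(e_2)=\tau$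 and $g'=g$ if $l(e_1)=\tau$, and $l(e_2)=l(e_1)$ and $g'=g\cup\{(e_1,e_2)\}$ otherwise, such that $(\pi_1,g,\pi_2')\in\mathcal R$ and $(\pi_1',g',\pi_2'')\in\mathcal R$; \end{itemize} and symmetrically if $\pi_2$ moves first. $m_1\approx_{bfc}m_2$ means that some branching fc-bisimulation contains a triple $((C_1,\rho_1),\emptyset,(C_2,\rho_2))$ where $C_1,C_2$ have no events and $\rho_i(Min(C_i))=\rho_i(Max(C_i))=m_i$ for $i=1,2$. -/

import Mathlib

namespace PetriNet

/-! Multisets are Mathlib's `Multiset`: union `⊕` is `+`, truncated difference `⊖` is `-`,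
inclusion is `≤`, size is `card`, and the empty multiset `θ` is `0`. -/

/-- A transition over places in `P` and labels in `A`: a triple (pre-set, label, post-set). -/
@[ext]
structure Transition (P A : Type*) where
  pre : Multiset P
  label : A
  post : Multiset P

/-- A (finite, labelled) place/transition net `(S, A, T)`, with places drawn from `P` and labels
drawn from `A`. -/
structure PTNet (P A : Type*) where
  places : Finset P
  labels : Finset A
  trans : Finset (Transition P A)
  pre_ne_zero : ∀ t ∈ trans, t.pre ≠ 0
  pre_subset : ∀ t ∈ trans, ∀ s ∈ t.pre, s ∈ places
  post_subset : ∀ t ∈ trans, ∀ s ∈ t.post, s ∈ places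
  label_mem : ∀ t ∈ trans, t.label ∈ labels

/-- A marked net (P/T net system). -/
structure MarkedNet (P A : Type*) extends PTNet P A where
  initial : Multiset P
  initial_subset : ∀ s ∈ initial, s ∈ places

section Classical

open scoped Classical

noncomputable section

/-! ### Firing and transition sequences -/

section Firing

variable {P A : Type*}

/-- `m [t⟩ m'`. -/
def Fires (m : Multiset P) (t : Transition P A) (m' : Multiset P) : Prop :=
  t.pre ≤ m ∧ m' = m - t.pre + t.post

/-- `m [σ⟩ m'`. -/
def FiresSeq : Multiset P → List (Transition P A) → Multiset P → Prop
  | m, [], m' => m' = m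
  | m, t :: σ, m' => ∃ m'', Fires m t m'' ∧ FiresSeq m'' σ m'

/-- Pre-set of a transition sequence. -/
def preSeq : List (Transition P A) → Multiset P
  | [] => 0
  | t :: σ => t.pre + (preSeq σ - t.post)

/-- Post-set of a transition sequence. -/
def postSeq : List (Transition P A) → Multiset P
  | [] => 0
  | t :: σ => postSeq σ + (t.post - preSeq σ)

/-- The observable label `o(σ)`. -/
def obs (τ : A) : List (Transition P A) → List A
  | [] => []
  | t :: σ => if t.label ≠ τ then t.label :: obs τ σ else obs τ σ

/-- For `m = m₀ [t₁⟩ m₁ ⋯ [tₙ⟩ mₙ`, the list of markings `m₀, …, mₙ₋₁` (the last one excluded). -/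
def visited : Multiset P → List (Transition P A) → List (Multiset P)
  | _, [] => []
  | m, t :: σ => m :: visited (m - t.pre + t.post) σ

end Firing

/-! ### Silent sequential behaviour -/

section Silent

variable {P A : Type*}

/-- `t` is `τ`-sequential. -/
def TauSequential (τ : A) (t : Transition P A) : Prop :=
  t.label = τ ∧ t.post.card = 1 ∧ t.pre.card = 1

/-- The idling transition `i(s) = (s, τ, s)`. -/
def idling (τ : A) (s : P) : Transition P A := ⟨{s}, τ, {s}⟩

/-- `σ`, a nonempty sequence of transitions of `N` and idling transitions, is
`τ`-1-sequential. -/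
def TauOneSeq (N : PTNet P A) (τ : A) (σ : List (Transition P A)) : Prop :=
  σ ≠ [] ∧
  (∀ t ∈ σ, (t ∈ N.trans ∨ ∃ s ∈ N.places, t = idling τ s) ∧ TauSequential τ t) ∧
  σ.IsChain (fun t u => t.post = u.pre)

/-- `σ` is `τ`-sequential, i.e. `τ`-`k`-sequential for some `k ≥ 1`. -/
def TauSeq (N : PTNet P A) (τ : A) (σ : List (Transition P A)) : Prop :=
  ∃ L : List (List (Transition P A)), L ≠ [] ∧ (∀ δ ∈ L, TauOneSeq N τ δ) ∧ σ = L.flatten ∧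
    preSeq σ = (L.map preSeq).sum ∧ postSeq σ = (L.map postSeq).sum

/-- `Ψ(m, σ, Q)`: along the run of `σ` from its pre-set, `m` is related to every marking but
possibly the last one. -/
def Psi (m : Multiset P) (σ : List (Transition P A)) (Q : Multiset P → Multiset P → Prop) : Prop :=
  ∀ m' ∈ visited (preSeq σ) σ, Q m m'

/-- `Φ(σ, m, Q)`. -/
def Phi (σ : List (Transition P A)) (m : Multiset P) (Q : Multiset P → Multiset P → Prop) : Prop :=
  ∀ m' ∈ visited (preSeq σ) σ, Q m' m

end Silent

/-! ### Branching d-place bisimilarity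

A place relation on `S ∪ {θ}` is a relation on `Option P`, where `none` stands for `θ`. -/

section DPlace

variable {P A : Type*}

/-- An element of `S ∪ {θ}` viewed as a marking. -/
def toMarking : Option P → Multiset P
  | none => 0
  | some s => {s}

/-- The d-additive closure `R^⊙`. -/
inductive DAdd (R : Option P → Option P → Prop) : Multiset P → Multiset P → Prop
  | zero : DAdd R 0 0
  | add {r₁ r₂ : Option P} {m₁ m₂ : Multiset P} :
      R r₁ r₂ → DAdd R m₁ m₂ → DAdd R (toMarking r₁ + m₁) (toMarking r₂ + m₂)

/-- The additive closure of the restriction of `R` to pairs of places. (`Multiset.Rel` is the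
additive closure of a place relation.) -/
def AddBar (R : Option P → Option P → Prop) : Multiset P → Multiset P → Prop :=
  Multiset.Rel (fun s₁ s₂ => R (some s₁) (some s₂))

/-- `R` is a branching d-place bisimulation on `N`. -/
structure IsBranchingDPlaceBisim (N : PTNet P A) (τ : A) (R : Option P → Option P → Prop) :
    Prop where
  left_places : ∀ s r, R (some s) r → s ∈ N.places
  right_places : ∀ r s, R r (some s) → s ∈ N.places
  left : ∀ m₁ m₂, DAdd R m₁ m₂ → ∀ t₁ ∈ N.trans, ∀ m₁', Fires m₁ t₁ m₁' →
    (TauSequential τ t₁ ∧ ∃ σ m₂', TauSeq N τ σ ∧ FiresSeq m₂ σ m₂' ∧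
      Psi t₁.pre σ (AddBar R) ∧ AddBar R t₁.pre (postSeq σ) ∧ AddBar R t₁.post (postSeq σ) ∧
      DAdd R (m₁ - t₁.pre) (m₂ - preSeq σ)) ∨
    (∃ σ, ∃ t₂ ∈ N.trans, ∃ m m₂', TauSeq N τ σ ∧ FiresSeq m₂ σ m ∧ Fires m t₂ m₂' ∧
      t₁.label = t₂.label ∧ postSeq σ = t₂.pre ∧ Psi t₁.pre σ (AddBar R) ∧
      AddBar R t₁.pre t₂.pre ∧ DAdd R t₁.post t₂.post ∧
      DAdd R (m₁ - t₁.pre) (m₂ - preSeq σ))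
  right : ∀ m₁ m₂, DAdd R m₁ m₂ → ∀ t₂ ∈ N.trans, ∀ m₂', Fires m₂ t₂ m₂' →
    (TauSequential τ t₂ ∧ ∃ σ m₁', TauSeq N τ σ ∧ FiresSeq m₁ σ m₁' ∧
      Phi σ t₂.pre (AddBar R) ∧ AddBar R (postSeq σ) t₂.pre ∧ AddBar R (postSeq σ) t₂.post ∧
      DAdd R (m₁ - preSeq σ) (m₂ - t₂.pre)) ∨
    (∃ σ, ∃ t₁ ∈ N.trans, ∃ m m₁', TauSeq N τ σ ∧ FiresSeq m₁ σ m ∧ Fires m t₁ m₁' ∧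
      t₁.label = t₂.label ∧ postSeq σ = t₁.pre ∧ Phi σ t₂.pre (AddBar R) ∧
      AddBar R t₁.pre t₂.pre ∧ DAdd R t₁.post t₂.post ∧
      DAdd R (m₁ - preSeq σ) (m₂ - t₂.pre))

/-- Branching d-place bisimilarity `m₁ ≈_d m₂`. -/
def BranchingDPlaceBisimilar (N : PTNet P A) (τ : A) (m₁ m₂ : Multiset P) : Prop :=
  ∃ R : Option P → Option P → Prop, IsBranchingDPlaceBisim N τ R ∧ DAdd R m₁ m₂

end DPlace

/-! ### Causal nets -/

section Causal

variable {X A : Type*}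

/-- The flow relation on places and transitions. -/
inductive Flow (N : PTNet X A) : X ⊕ Transition X A → X ⊕ Transition X A → Prop
  | pre {b : X} {e : Transition X A} : e ∈ N.trans → b ∈ e.pre → Flow N (.inl b) (.inr e)
  | post {b : X} {e : Transition X A} : e ∈ N.trans → b ∈ e.post → Flow N (.inr e) (.inl b)

/-- The flow relation has no cycle. -/
def Acyclic (N : PTNet X A) : Prop := ∀ x, ¬ Relation.TransGen (Flow N) x x

/-- Pre-set of a place: the transitions producing it. -/
def PTNet.preOf (N : PTNet X A) (b : X) : Finset (Transition X A) :=
  N.trans.filter (fun e => b ∈ e.post)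

/-- Post-set of a place: the transitions consuming it. -/
def PTNet.postOf (N : PTNet X A) (b : X) : Finset (Transition X A) :=
  N.trans.filter (fun e => b ∈ e.pre)

/-- Causal nets; places are called conditions, transitions are called events. -/
structure IsCausal (C : MarkedNet X A) : Prop where
  acyclic : Acyclic C.toPTNet
  unbranched : ∀ b ∈ C.places, (C.preOf b).card ≤ 1 ∧ (C.postOf b).card ≤ 1
  initial_count : ∀ b ∈ C.places, C.initial.count b = if C.preOf b = ∅ then 1 else 0
  weight_one : ∀ e ∈ C.trans, ∀ b, e.pre.count b ≤ 1 ∧ e.post.count b ≤ 1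

/-- `Min(C)`, the initial marking. -/
def minC (C : MarkedNet X A) : Multiset X := C.initial

/-- `Max(C)`, the set of conditions with empty post-set. -/
def maxC (C : MarkedNet X A) : Multiset X := (C.places.filter (fun b => C.postOf b = ∅)).val

/-- `C [e⟩ C'` for causal nets. -/
def CausalMove (C : MarkedNet X A) (e : Transition X A) (C' : MarkedNet X A) : Prop :=
  IsCausal C ∧ IsCausal C' ∧ C'.labels = C.labels ∧ C'.initial = C.initial ∧
  e.pre ≤ maxC C ∧ C'.trans = insert e C.trans ∧ C'.places = C.places ∪ e.post.toFinset

/-- The order `e₁ ⪯ e₂` on events. -/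
def EventLE (C : MarkedNet X A) (e₁ e₂ : Transition X A) : Prop :=
  Relation.ReflTransGen (Flow C.toPTNet) (.inr e₁) (.inr e₂)

/-- The observable events of `C`. -/
def obsEvents (τ : A) (C : MarkedNet X A) : Set (Transition X A) :=
  {e | e ∈ C.trans ∧ e.label ≠ τ}

/-- `g` is (the graph of) an abstract event isomorphism between `C₁` and `C₂`: a label-preserving
order isomorphism between their partial orders of observable events. -/
structure IsAbstractEventIso (τ : A) (C₁ C₂ : MarkedNet X A)
    (g : Set (Transition X A × Transition X A)) : Prop where
  subset : g ⊆ obsEvents τ C₁ ×ˢ obsEvents τ C₂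
  existsUnique_right : ∀ e₁ ∈ obsEvents τ C₁, ∃! e₂, (e₁, e₂) ∈ g
  existsUnique_left : ∀ e₂ ∈ obsEvents τ C₂, ∃! e₁, (e₁, e₂) ∈ g
  label_eq : ∀ e₁ e₂, (e₁, e₂) ∈ g → e₁.label = e₂.label
  le_iff : ∀ e₁ e₂ e₁' e₂', (e₁, e₂) ∈ g → (e₁', e₂') ∈ g →
    (EventLE C₁ e₁ e₁' ↔ EventLE C₂ e₂ e₂')

end Causal

/-! ### Processes of a net

Conditions of causal nets are drawn from a type `X` of names. -/

/-- A causal net together with a map `ρ` on its conditions and events. The map is a pair of partial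
functions (`none` means undefined). -/
structure NetProc (X P A : Type*) where
  net : MarkedNet X A
  onPlaces : X → Option P
  onTrans : Transition X A → Option (Transition P A)

section Processes

variable {X P A : Type*}

/-- The image under `ρ` of a multiset of conditions. -/
def NetProc.image (π : NetProc X P A) (m : Multiset X) : Multiset P := m.filterMap π.onPlaces

/-- `π = (C, ρ)` is a process of `N(m₀)`: `C` is a causal net and `ρ : B ∪ E → S ∪ T` is a folding
from `C` to `N(m₀)`. -/
structure IsProcess (N : PTNet P A) (m₀ : Multiset P) (π : NetProc X P A) : Prop where
  causal : IsCausal π.net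
  dom_places : ∀ b, (π.onPlaces b).isSome ↔ b ∈ π.net.places
  dom_trans : ∀ e, (π.onTrans e).isSome ↔ e ∈ π.net.trans
  map_places : ∀ b s, π.onPlaces b = some s → s ∈ N.places
  map_trans : ∀ e t, π.onTrans e = some t → t ∈ N.trans
  labels_eq : π.net.labels = N.labels
  label_eq : ∀ e t, π.onTrans e = some t → e.label = t.label
  initial_eq : π.image π.net.initial = m₀
  pre_eq : ∀ e t, π.onTrans e = some t → π.image e.pre = t.pre
  post_eq : ∀ e t, π.onTrans e = some t → π.image e.post = t.post

/-- `π -e→ π'`, for processes of a common marked net `N(m₀)`. -/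
def ProcMove (N : PTNet P A) (π : NetProc X P A) (e : Transition X A) (π' : NetProc X P A) :
    Prop :=
  (∃ m₀, IsProcess N m₀ π ∧ IsProcess N m₀ π') ∧ CausalMove π.net e π'.net ∧
  (∀ b s, π.onPlaces b = some s → π'.onPlaces b = some s) ∧
  (∀ d t, π.onTrans d = some t → π'.onTrans d = some t)

/-- `π =σ⇒ π'`. -/
inductive ProcMoves (N : PTNet P A) :
    NetProc X P A → List (Transition X A) → NetProc X P A → Prop
  | nil (π : NetProc X P A) : ProcMoves N π [] π
  | cons {π π' π'' : NetProc X P A} {e : Transition X A} {σ : List (Transition X A)} :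
      ProcMove N π e π' → ProcMoves N π' σ π'' → ProcMoves N π (e :: σ) π''

/-- `R` is a branching fully-concurrent bisimulation on `N`. -/
structure IsBranchingFCBisim (N : PTNet P A) (τ : A)
    (R : NetProc X P A → Set (Transition X A × Transition X A) → NetProc X P A → Prop) :
    Prop where
  process_left : ∀ π₁ g π₂, R π₁ g π₂ → ∃ m₀, IsProcess N m₀ π₁
  process_right : ∀ π₁ g π₂, R π₁ g π₂ → ∃ m₀, IsProcess N m₀ π₂
  iso : ∀ π₁ g π₂, R π₁ g π₂ → IsAbstractEventIso τ π₁.net π₂.net g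
  left : ∀ π₁ g π₂, R π₁ g π₂ → ∀ e₁ π₁', ProcMove N π₁ e₁ π₁' →
    (e₁.label = τ ∧ ∃ σ₂ π₂', obs τ σ₂ = [] ∧ ProcMoves N π₂ σ₂ π₂' ∧
      R π₁ g π₂' ∧ R π₁' g π₂') ∨
    (∃ σ e₂ π₂' π₂'' g', obs τ σ = [] ∧ ProcMoves N π₂ σ π₂' ∧ ProcMove N π₂' e₂ π₂'' ∧
      (e₁.label = τ → e₂.label = τ ∧ g' = g) ∧
      (e₁.label ≠ τ → e₁.label = e₂.label ∧ g' = g ∪ {(e₁, e₂)}) ∧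
      R π₁ g π₂' ∧ R π₁' g' π₂'')
  right : ∀ π₁ g π₂, R π₁ g π₂ → ∀ e₂ π₂', ProcMove N π₂ e₂ π₂' →
    (e₂.label = τ ∧ ∃ σ₁ π₁', obs τ σ₁ = [] ∧ ProcMoves N π₁ σ₁ π₁' ∧
      R π₁' g π₂ ∧ R π₁' g π₂') ∨
    (∃ σ e₁ π₁' π₁'' g', obs τ σ = [] ∧ ProcMoves N π₁ σ π₁' ∧ ProcMove N π₁' e₁ π₁'' ∧
      (e₂.label = τ → e₁.label = τ ∧ g' = g) ∧
      (e₂.label ≠ τ → e₁.label = e₂.label ∧ g' = g ∪ {(e₁, e₂)}) ∧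
      R π₁' g π₂ ∧ R π₁'' g' π₂')

/-- Branching fully-concurrent bisimilarity `m₁ ≈_bfc m₂`. The processes have conditions named by
elements of `X`; this is meaningful when `X` is infinite, so that fresh names never run out. -/
def BranchingFCBisimilar (X : Type*) (N : PTNet P A) (τ : A) (m₁ m₂ : Multiset P) : Prop :=
  ∃ R : NetProc X P A → Set (Transition X A × Transition X A) → NetProc X P A → Prop,
    IsBranchingFCBisim N τ R ∧
    ∃ π₁ π₂, R π₁ ∅ π₂ ∧
      π₁.net.trans = ∅ ∧ π₂.net.trans = ∅ ∧
      π₁.image (minC π₁.net) = m₁ ∧ π₁.image (maxC π₁.net) = m₁ ∧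
      π₂.image (minC π₂.net) = m₂ ∧ π₂.image (maxC π₂.net) = m₂

end Processes

end

end Classical

end PetriNet

/-! ### Tokenwise relations between multisets -/

namespace Multiset

variable {α β γ : Type*}

/-! Let $R$ be a branching d-place bisimulation, enlarged by $(\theta,\theta)$. Matching tokens by
$R$ itself does not survive a silent answer: the definition relates a whole pre-set to the marking
reached, possibly by a new pairing of tokens, whereas causality needs each token to stay matched
with the partner whose past corresponds to its own. So $R$ is replaced by connectivity: join two
copies of $S\cup\{\theta\}$ by $R$ and colour every element by its component. Along a silent answer
the multiset of colours is constant, and each step replaces one token by one token; hence every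
single token keeps its colour (`rel_tokPath_of_firesSeq`).

Equal colours mean that each token of a pre-set is joined to its partner by a walk. Backtracking
makes these walks equally long, and the transition is carried along all of them together, one edge
at a time (`answer_comp`, `answer_chain`). The bisimulation clauses are applied to the pre-set
alone, so their condition on the residual markings is not needed. Silent one-token paths found at
one stage have to be imitated at the next (`transfer_path`). The imitating transition may create
extra tokens related to $\theta$, which is why `TokStep` tolerates by-products with the colour of
$\theta$. The outcome is `Answer`: either the transition is a colour-preserving silent move of one
token, which needs no reply, or each partner follows its own silent path and then a transition with
the same label produces the same colours.

The fc-bisimulation is `Linked`: the maximal conditions without the colour of $\theta$ are matched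
bijectively, with equal colours and with observable pasts corresponding along $g$. `Linked.simulate`
lifts answers to processes. Silent paths leave the past of a token unchanged, and the conditions
produced by the answering event all receive the union of the consumed pasts together with that event
if it is observable, so they correspond on both sides. -/

theorem Rel.comp {r : α → β → Prop} {p : β → γ → Prop} {s : Multiset α} {t : Multiset β}
    {u : Multiset γ} (h₁ : Rel r s t) (h₂ : Rel p t u) : Rel (Relation.Comp r p) s u := by
  induction h₁ generalizing u with
  | zero => rw [rel_zero_left] at h₂; subst h₂; exact Rel.zero
  | @cons a b _ _ hab _ ih =>
    obtain ⟨c, u', hc, hu, rfl⟩ := rel_cons_left.1 h₂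
    exact Rel.cons ⟨b, hab, hc⟩ (ih hu)

theorem Rel.exists_mid {r : α → γ → Prop} {p : α → β → Prop} {q : β → γ → Prop} {s : Multiset α}
    {u : Multiset γ} (h : Rel r s u) (hr : ∀ a c, r a c → ∃ b, p a b ∧ q b c) :
    ∃ t, Rel p s t ∧ Rel q t u := by
  induction h with
  | zero => exact ⟨0, Rel.zero, Rel.zero⟩
  | cons hab _ ih =>
    obtain ⟨t, h₁, h₂⟩ := ih
    obtain ⟨b, hb₁, hb₂⟩ := hr _ _ hab
    exact ⟨b ::ₘ t, Rel.cons hb₁ h₁, Rel.cons hb₂ h₂⟩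

theorem Rel.imp {r p : α → β → Prop} {s : Multiset α} {t : Multiset β}
    (h : Rel r s t) (hr : ∀ a b, r a b → p a b) : Rel p s t :=
  h.mono fun a _ b _ => hr a b

theorem Rel.map_eq {δ : Type*} {f : α → δ} {g : β → δ} {s : Multiset α} {t : Multiset β}
    (h : Rel (fun a b => f a = g b) s t) : s.map f = t.map g :=
  rel_eq.1 (rel_map.2 h)

theorem Rel.reflTransGen_trans {r : α → α → Prop} {s t u : Multiset α}
    (h₁ : Rel (Relation.ReflTransGen r) s t) (h₂ : Rel (Relation.ReflTransGen r) t u) :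
    Rel (Relation.ReflTransGen r) s u :=
  (h₁.comp h₂).imp fun _ _ ⟨_, h, h'⟩ => h.trans h'

theorem eq_map_some_of_card_le {r : Multiset (Option α)}
    (h : r.card ≤ (r.filterMap id).card) : r = (r.filterMap id).map some := by
  induction r using Multiset.induction_on with
  | empty => rfl
  | cons x r ih =>
    have hle : (r.filterMap id).card ≤ r.card := by
      induction r using Quotient.inductionOn; simpa using List.length_filterMap_le _ _
    cases x with
    | none =>
      rw [filterMap_cons_none _ _ rfl, card_cons] at h
      omega
    | some a =>
      rw [filterMap_cons_some id _ _ rfl] at h ⊢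
      simp only [card_cons, map_cons] at h ⊢
      rw [← ih (by omega)]

end Multiset

namespace PetriNet

open scoped Classical

open Relation (ReflTransGen TransGen)

/-! ### Colours of tokens and silent one-token steps -/

section Colours

variable {P A K : Type*}

/-- The colours of the tokens of `m` other than the colour of `θ`. -/
noncomputable def colours (κ : Option P → K) (m : Multiset P) : Multiset K :=
  (m.map fun s => κ (some s)).filter (· ≠ κ none)

theorem colours_add (κ : Option P → K) (m n : Multiset P) :
    colours κ (m + n) = colours κ m + colours κ n := by
  simp [colours]

theorem colours_toMarking (κ : Option P → K) (r : Option P) :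
    colours κ (toMarking r) = Multiset.filter (· ≠ κ none) {κ r} := by
  cases r with
  | none => simp [colours, toMarking, Multiset.filter_singleton]
  | some s => simp [colours, toMarking]

theorem colours_congr {κ κ' : Option P → K} (h0 : κ none = κ' none) {m n : Multiset P}
    (h : m.map (fun s => κ (some s)) = n.map (fun s => κ' (some s))) :
    colours κ m = colours κ' n := by
  rw [colours, colours, h, h0]

theorem colours_eq_of_rel {κ κ' : Option P → K} (h0 : κ none = κ' none) {m n : Multiset P}
    (h : Multiset.Rel (fun a b => κ (some a) = κ' (some b)) m n) : colours κ m = colours κ' n :=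
  colours_congr h0 h.map_eq

/-- The closure may also pair a place with $\theta$; such a place has the colour of $\theta$ and is
discarded by `colours`. -/
theorem DAdd.colours_eq {R : Option P → Option P → Prop} {κ κ' : Option P → K}
    (h0 : κ none = κ' none) (hR : ∀ x y, R x y → κ x = κ' y) {m n : Multiset P}
    (h : DAdd R m n) : colours κ m = colours κ' n := by
  induction h with
  | zero => simp [colours]
  | add hr _ ih => rw [colours_add, colours_add, ih, colours_toMarking, colours_toMarking, hR _ _ hr, h0]

/-- A silent step of a single token that keeps its colour and produces nothing else but tokens
with the colour of `θ`. -/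
def TokStep (N : PTNet P A) (τ : A) (κ : Option P → K) (z z' : P) : Prop :=
  ∃ u ∈ N.trans, u.label = τ ∧ u.pre = {z} ∧ κ (some z') = κ (some z) ∧
    ∃ w, u.post = z' ::ₘ w ∧ ∀ x ∈ w, κ (some x) = κ none

theorem TokStep.colour_eq {N : PTNet P A} {τ : A} {κ : Option P → K} {z z' : P}
    (h : ReflTransGen (TokStep N τ κ) z z') : κ (some z') = κ (some z) := by
  induction h with
  | refl => rfl
  | tail _ h ih =>
    obtain ⟨u, -, -, -, h, -⟩ := h
    rw [h, ih]

theorem colours_eq_zero {κ : Option P → K} {m : Multiset P} :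
    colours κ m = 0 ↔ ∀ x ∈ m, κ (some x) = κ none := by
  simp [colours, Multiset.filter_eq_nil]

/-- Cancelling the colour common to `z` and `z'` leaves no colours for `w`. This identifies the
by-products of a `TokStep`. -/
theorem rest_zero_of_colours_eq_singleton {κ : Option P → K} {z z' : P} {w : Multiset P}
    (h : colours κ (z' ::ₘ w) = colours κ {z}) (hz : κ (some z') = κ (some z)) :
    ∀ x ∈ w, κ (some x) = κ none := by
  rw [← colours_eq_zero]
  rw [← Multiset.singleton_add, colours_add] at h
  have : colours κ {z'} = colours κ {z} := by simp [colours, hz]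
  rwa [this, add_eq_left] at h

end Colours

/-! ### Silent sequences as families of one-token paths -/

section Sequences

variable {P A : Type*}

theorem FiresSeq.spec {m m' : Multiset P} {σ : List (Transition P A)} (h : FiresSeq m σ m') :
    preSeq σ ≤ m ∧ m' = m - preSeq σ + postSeq σ := by
  induction σ generalizing m with
  | nil => simp only [FiresSeq] at h; simp [preSeq, postSeq, h]
  | cons t σ ih =>
    obtain ⟨m'', ⟨h₁, rfl⟩, h₂⟩ := h
    obtain ⟨h₃, h₄⟩ := ih h₂
    simp only [preSeq, postSeq]
    constructor
    · rw [Multiset.le_iff_count] at *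
      intro a
      have := h₁ a; have := h₃ a
      simp only [Multiset.count_add, Multiset.count_sub] at *
      omega
    · rw [h₄]
      rw [Multiset.le_iff_count] at h₁ h₃
      ext a
      have := h₁ a; have := h₃ a
      simp only [Multiset.count_add, Multiset.count_sub] at *
      omega

theorem FiresSeq.card_eq {m m' : Multiset P} {σ : List (Transition P A)} (h : FiresSeq m σ m')
    (hσ : ∀ t ∈ σ, t.pre.card = 1 ∧ t.post.card = 1) : m'.card = m.card := by
  induction σ generalizing m with
  | nil => simp only [FiresSeq] at h; rw [h]
  | cons t σ ih =>
    obtain ⟨m'', ⟨h₁, rfl⟩, h₂⟩ := h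
    have h₃ := hσ t (by simp)
    have h₄ := Multiset.card_le_card h₁
    rw [ih h₂ fun u hu => hσ u (by simp [hu]), Multiset.card_add, Multiset.card_sub h₁]
    omega

theorem TauSeq.forall_mem {N : PTNet P A} {τ : A} {σ : List (Transition P A)}
    (h : TauSeq N τ σ) :
    ∀ t ∈ σ, (t ∈ N.trans ∨ ∃ s ∈ N.places, t = idling τ s) ∧ TauSequential τ t := by
  obtain ⟨L, -, hL, rfl, -, -⟩ := h
  intro t ht
  obtain ⟨δ, hδ, htδ⟩ := List.mem_flatten.1 ht
  exact (hL δ hδ).2.1 t htδ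

/-- If the multiset of colours never changes and each transition exchanges one token for one token,
then the exchanged token keeps its colour. The run therefore splits into independent
colour-preserving paths, whatever its interleaving. -/
theorem rel_tokPath_of_firesSeq {K : Type*} {N : PTNet P A} {τ : A} {κ : Option P → K}
    {C : Multiset K} {σ : List (Transition P A)}
    (hσ : ∀ t ∈ σ, (t ∈ N.trans ∨ ∃ s ∈ N.places, t = idling τ s) ∧ TauSequential τ t)
    {q q' : Multiset P} (h : FiresSeq q σ q')
    (hv : ∀ m ∈ visited q σ, m.map (fun s => κ (some s)) = C)
    (hq' : q'.map (fun s => κ (some s)) = C) :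
    Multiset.Rel (ReflTransGen (TokStep N τ κ)) q q' := by
  induction σ generalizing q with
  | nil =>
    simp only [FiresSeq] at h
    subst h
    exact Multiset.rel_refl_of_refl_on fun _ _ => ReflTransGen.refl
  | cons t σ ih =>
    obtain ⟨q₁, ⟨h₁, rfl⟩, h₂⟩ := h
    have hσ' := fun u hu => hσ u (List.mem_cons_of_mem t hu)
    simp only [visited, List.mem_cons, forall_eq_or_imp] at hv
    refine Multiset.Rel.reflTransGen_trans ?_ (ih hσ' h₂ hv.2)
    -- `visited` omits the last marking: the marking after `t` is either visited later or equal to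
    -- `q'`.
    have hC : (q - t.pre + t.post).map (fun s => κ (some s)) = C := by
      cases σ with
      | nil => simp only [FiresSeq] at h₂; rw [← h₂, hq']
      | cons u σ => exact hv.2 _ (by simp [visited])
    obtain ⟨ht, hτ, hpost, hpre⟩ := hσ t (by simp)
    obtain ⟨s, hs⟩ := Multiset.card_eq_one.1 hpre
    obtain ⟨s', hs'⟩ := Multiset.card_eq_one.1 hpost
    obtain ⟨q₀, rfl⟩ := Multiset.le_iff_exists_add.1 h₁
    rw [add_tsub_cancel_left] at hC ⊢
    have hκ : κ (some s') = κ (some s) := by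
      have := hC.trans hv.1.symm
      simpa [hs, hs', Multiset.map_add, add_comm] using this
    rw [add_comm q₀]
    refine Multiset.Rel.add ?_ (Multiset.rel_refl_of_refl_on fun _ _ => ReflTransGen.refl)
    rw [hs, hs']
    refine Multiset.Rel.cons ?_ Multiset.Rel.zero
    rcases ht with ht | ⟨x, -, rfl⟩
    · exact ReflTransGen.single ⟨t, ht, hτ, hs, hκ, 0, hs', by simp⟩
    · simp only [idling, Multiset.singleton_inj] at hs hs'
      rw [← hs, ← hs']

end Sequences

/-! ### Converses of bisimulations and the pair of empty markings -/

section PlaceRelations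

variable {P A : Type*}

theorem DAdd.flip {R : Option P → Option P → Prop} {m n : Multiset P} (h : DAdd R m n) :
    DAdd (flip R) n m := by
  induction h with
  | zero => exact DAdd.zero
  | add hr _ ih => exact DAdd.add (R := _root_.flip R) hr ih

theorem dAdd_flip {R : Option P → Option P → Prop} {m n : Multiset P} :
    DAdd (flip R) m n ↔ DAdd R n m :=
  ⟨fun h => h.flip, fun h => h.flip⟩

theorem addBar_flip {R : Option P → Option P → Prop} {m n : Multiset P} :
    AddBar (flip R) m n ↔ AddBar R n m :=
  Multiset.rel_flip (r := fun s₁ s₂ => R (some s₁) (some s₂))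

theorem IsBranchingDPlaceBisim.flip {N : PTNet P A} {τ : A} {R : Option P → Option P → Prop}
    (h : IsBranchingDPlaceBisim N τ R) : IsBranchingDPlaceBisim N τ (flip R) where
  left_places s r hs := h.right_places r s hs
  right_places r s hs := h.left_places s r hs
  left m₁ m₂ hm t₁ ht₁ m₁' hf := by
    rcases h.right m₂ m₁ (dAdd_flip.1 hm) t₁ ht₁ m₁' hf with
      ⟨h1, σ, m', h2, h3, h4, h5, h6, h7⟩ | ⟨σ, t, ht, m, m', h1, h2, h3, h4, h5, h6, h7, h8, h9⟩
    · exact Or.inl ⟨h1, σ, m', h2, h3, fun x hx => addBar_flip.2 (h4 x hx), addBar_flip.2 h5,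
        addBar_flip.2 h6, dAdd_flip.2 h7⟩
    · exact Or.inr ⟨σ, t, ht, m, m', h1, h2, h3, h4.symm, h5,
        fun x hx => addBar_flip.2 (h6 x hx), addBar_flip.2 h7, dAdd_flip.2 h8, dAdd_flip.2 h9⟩
  right m₁ m₂ hm t₁ ht₁ m₁' hf := by
    rcases h.left m₂ m₁ (dAdd_flip.1 hm) t₁ ht₁ m₁' hf with
      ⟨h1, σ, m', h2, h3, h4, h5, h6, h7⟩ | ⟨σ, t, ht, m, m', h1, h2, h3, h4, h5, h6, h7, h8, h9⟩
    · exact Or.inl ⟨h1, σ, m', h2, h3, fun x hx => addBar_flip.2 (h4 x hx), addBar_flip.2 h5,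
        addBar_flip.2 h6, dAdd_flip.2 h7⟩
    · exact Or.inr ⟨σ, t, ht, m, m', h1, h2, h3, h4.symm, h5,
        fun x hx => addBar_flip.2 (h6 x hx), addBar_flip.2 h7, dAdd_flip.2 h8, dAdd_flip.2 h9⟩

/-- The relation `R` together with the pair `(θ, θ)`. -/
def withNone (R : Option P → Option P → Prop) (x y : Option P) : Prop :=
  R x y ∨ (x = none ∧ y = none)

/-- The pair $(\theta,\theta)$ only adds empty markings, so $R$ may be assumed to contain it;
$\theta$ then has the same colour on both sides. -/
theorem dAdd_withNone (R : Option P → Option P → Prop) : DAdd (withNone R) = DAdd R := by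
  ext m n
  constructor
  · intro h
    induction h with
    | zero => exact DAdd.zero
    | add hr _ ih =>
      rcases hr with hr | ⟨rfl, rfl⟩
      · exact DAdd.add hr ih
      · simpa [toMarking] using ih
  · intro h
    induction h with
    | zero => exact DAdd.zero
    | add hr _ ih => exact DAdd.add (Or.inl hr) ih

theorem addBar_withNone (R : Option P → Option P → Prop) : AddBar (withNone R) = AddBar R := by
  simp [AddBar, withNone]

theorem IsBranchingDPlaceBisim.withNone {N : PTNet P A} {τ : A} {R : Option P → Option P → Prop}
    (h : IsBranchingDPlaceBisim N τ R) : IsBranchingDPlaceBisim N τ (withNone R) where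
  left_places s r hs := h.left_places s r (by simpa [PetriNet.withNone] using hs)
  right_places r s hs := h.right_places r s (by simpa [PetriNet.withNone] using hs)
  left := by rw [dAdd_withNone, addBar_withNone]; exact h.left
  right := by rw [dAdd_withNone, addBar_withNone]; exact h.right

/-- This turns a prescribed partner for each token, where `none` means no partner, into an instance
of the closure to which the bisimulation clauses apply. -/
theorem dAdd_of_rel {R : Option P → Option P → Prop} {m : Multiset P} {r : Multiset (Option P)}
    (h : Multiset.Rel (fun a x => R (some a) x) m r) : DAdd R m (r.filterMap id) := by
  induction h with
  | zero => exact DAdd.zero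
  | @cons a x m r hax _ ih =>
    have := DAdd.add hax ih
    cases x with
    | none => rwa [Multiset.filterMap_cons_none _ _ rfl, ← zero_add (Multiset.filterMap id r)]
    | some y => rwa [Multiset.filterMap_cons_some id _ _ rfl, ← Multiset.singleton_add]

theorem DAdd.exists_of_mem {R : Option P → Option P → Prop} {m n : Multiset P}
    (h : DAdd R m n) : ∀ a ∈ m, R (some a) none ∨ ∃ b w, n = b ::ₘ w ∧ R (some a) (some b) := by
  induction h with
  | zero => simp
  | @add x y m n hr _ ih =>
    intro a ha
    rcases Multiset.mem_add.1 ha with ha | ha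
    · cases x with
      | none => simp [toMarking] at ha
      | some a' =>
        obtain rfl : a = a' := by simpa [toMarking] using ha
        cases y with
        | none => exact Or.inl hr
        | some b => exact Or.inr ⟨b, n, rfl, hr⟩
    · rcases ih a ha with h | ⟨b, w, rfl, h⟩
      · exact Or.inl h
      · exact Or.inr ⟨b, toMarking y + w, by simp, h⟩

end PlaceRelations

/-! ### Transferring transitions and silent paths along a bisimulation -/

section Transfer

variable {P A K : Type*}

/-- One-step transfer along a branching d-place bisimulation, token by token. -/
theorem IsBranchingDPlaceBisim.transfer {N : PTNet P A} {τ : A} {R : Option P → Option P → Prop}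
    (h : IsBranchingDPlaceBisim N τ R) {κ κ' : Option P → K} (hR : ∀ x y, R x y → κ x = κ' y)
    {t : Transition P A} (ht : t ∈ N.trans) {r : Multiset (Option P)}
    (hr : Multiset.Rel (fun a x => R (some a) x) t.pre r) :
    ∃ q, r = q.map some ∧
      ((TauSequential τ t ∧ ∃ y, Multiset.Rel (ReflTransGen (TokStep N τ κ')) q y ∧
          AddBar R t.post y) ∨
        ∃ t₂ ∈ N.trans, t.label = t₂.label ∧ DAdd R t.post t₂.post ∧
          Multiset.Rel (ReflTransGen (TokStep N τ κ')) q t₂.pre) := by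
  -- Both clauses begin with the same silent sequence; here it is shown to use up `r` entirely and
  -- to split into paths.
  have key : ∀ σ q', TauSeq N τ σ → FiresSeq (r.filterMap id) σ q' →
      Psi t.pre σ (AddBar R) → AddBar R t.pre (postSeq σ) →
      r = (r.filterMap id).map some ∧
        Multiset.Rel (ReflTransGen (TokStep N τ κ')) (r.filterMap id) (postSeq σ) := by
    intro σ q' hσ hf hψ hpost
    have h1 := hf.spec
    have h2 := hf.card_eq fun t ht => ⟨(hσ.forall_mem t ht).2.2.2, (hσ.forall_mem t ht).2.2.1⟩
    have h3 := Multiset.card_eq_card_of_rel hpost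
    have h4 := Multiset.card_eq_card_of_rel hr
    -- The run preserves the number of tokens, so the pre-set of `σ` is as large as its post-set,
    -- hence as `t.pre` and as `r`. It fits inside the places occurring in `r`, so no entry of `r`
    -- is `none`.
    have h5 : r = (r.filterMap id).map some := by
      apply Multiset.eq_map_some_of_card_le
      have h6 := congrArg Multiset.card h1.2
      have h7 := Multiset.card_le_card h1.1
      rw [Multiset.card_add, Multiset.card_sub h1.1] at h6
      omega
    refine ⟨h5, ?_⟩
    have h8 : preSeq σ = r.filterMap id := by
      apply Multiset.eq_of_le_of_card_le h1.1
      have h6 := congrArg Multiset.card h1.2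
      have h7 := Multiset.card_le_card h1.1
      have h9 := congrArg Multiset.card h5
      rw [Multiset.card_map] at h9
      rw [Multiset.card_add, Multiset.card_sub h1.1] at h6
      omega
    have h10 : q' = postSeq σ := by rw [h1.2, h8, tsub_self, zero_add]
    subst h10
    -- The constant multiset of colours is that of `t.pre`, to which every marking of the run is
    -- related.
    refine rel_tokPath_of_firesSeq (C := t.pre.map fun s => κ (some s)) hσ.forall_mem hf ?_ ?_
    · intro m hm
      rw [← h8] at hm
      exact ((hψ m hm).imp fun a b => hR _ _).map_eq.symm
    · exact (hpost.imp fun a b => hR _ _).map_eq.symm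
  -- The marking challenged is `t.pre` itself, so only the partners of consumed tokens can be used
  -- in the answer.
  rcases h.left _ _ (dAdd_of_rel hr) t ht _ ⟨le_rfl, rfl⟩ with
    ⟨h1, σ, m', h2, h3, h4, h5, h6, -⟩ | ⟨σ, t₂, ht₂, m, m', h1, h2, h3, h4, h5, h6, h7, h8, -⟩
  · obtain ⟨hq, hp⟩ := key σ m' h2 h3 h4 h5
    exact ⟨_, hq, Or.inl ⟨h1, _, hp, h6⟩⟩
  · rw [← h5] at h7
    obtain ⟨hq, hp⟩ := key σ m h1 h2 h6 h7
    exact ⟨_, hq, Or.inr ⟨t₂, ht₂, h4, h8, by rwa [← h5]⟩⟩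

/-- Each step is imitated by transferring its one-token transition. Of the tokens produced only the
one related to `y'` is followed; the path may instead end with `y'` related to $\theta$. -/
theorem IsBranchingDPlaceBisim.transfer_path {N : PTNet P A} {τ : A}
    {R : Option P → Option P → Prop} (h : IsBranchingDPlaceBisim N τ R) {κ κ' : Option P → K}
    (h0 : κ none = κ' none) (hR : ∀ x y, R x y → κ x = κ' y) {y y' : P} {r : Option P}
    (hr : R (some y) r) (hy : ReflTransGen (TokStep N τ κ) y y') :
    R (some y') none ∨
      ∃ z z', r = some z ∧ ReflTransGen (TokStep N τ κ') z z' ∧ R (some y') (some z') := by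
  induction hy with
  | refl =>
    cases r with
    | none => exact Or.inl hr
    | some z => exact Or.inr ⟨z, z, rfl, ReflTransGen.refl, hr⟩
  | @tail y₁ y₂ _ hs ih =>
    obtain ⟨u, hu, hτ, hpre, hκ, w, hw, hw0⟩ := hs
    rcases ih with ih | ⟨z, z₁, rfl, hz, ih⟩
    -- A token related to $\theta$ cannot take a further step, since `transfer` excludes `none`
    -- among the partners.
    · obtain ⟨q, hq, -⟩ := h.transfer hR hu (r := {none})
        (by rw [hpre]; exact Multiset.Rel.cons ih Multiset.Rel.zero)
      have : none ∈ q.map some := hq ▸ Multiset.mem_singleton_self _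
      simp at this
    · obtain ⟨q, hq, hq'⟩ := h.transfer hR hu (r := {some z₁})
        (by rw [hpre]; exact Multiset.Rel.cons ih Multiset.Rel.zero)
      obtain rfl : q = {z₁} := by
        have : q.map some = Multiset.map some {z₁} := by rw [← hq]; rfl
        exact Multiset.map_injective (Option.some_injective P) this
      rcases hq' with ⟨⟨-, hc, -⟩, x, hx, hx'⟩ | ⟨t₂, ht₂, hl, hd, hx⟩
      · obtain ⟨z₂, x', hz₂, hx0, rfl⟩ := Multiset.rel_cons_left.1 hx
        rw [Multiset.rel_zero_left] at hx0
        subst hx0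
        rw [hw, Multiset.card_cons, Nat.add_eq_right, Multiset.card_eq_zero] at hc
        subst hc
        rw [hw] at hx'
        obtain ⟨b, x', hb, -, hx0⟩ := Multiset.rel_cons_left.1 hx'
        have : z₂ = b := ((Multiset.cons_eq_cons.1 hx0).elim (fun h => h.1) fun h => by
          obtain ⟨_, c, h, -⟩ := h; exact absurd h (by simp))
        subst this
        exact Or.inr ⟨z, z₂, rfl, hz.trans hz₂, hb⟩
      · obtain ⟨z₂, x', hz₂, hx0, hx2⟩ := Multiset.rel_cons_left.1 hx
        rw [Multiset.rel_zero_left] at hx0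
        subst hx0
        rcases hd.exists_of_mem y₂ (by simp [hw]) with h1 | ⟨b, v, hv, h1⟩
        · exact Or.inl h1
        · refine Or.inr ⟨z, b, rfl, (hz.trans hz₂).tail ⟨t₂, ht₂, ?_, hx2, ?_, v, hv, ?_⟩, h1⟩
          · rw [← hl, hτ]
          · rw [← hR _ _ h1, hκ, hR _ _ ih, TokStep.colour_eq hz₂]
          · have hb : κ' (some b) = κ' (some z₂) := by
              rw [← hR _ _ h1, hκ, hR _ _ ih, TokStep.colour_eq hz₂]
            -- The post-sets of `u` and `t₂` have the same colours, and those of `u` reduce to the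
            -- colour of `y₂`; so everything in `t₂.post` besides `b` has the colour of $\theta$.
            refine rest_zero_of_colours_eq_singleton (z := z₂) ?_ hb
            rw [← hv, ← hd.colours_eq h0 hR, hw, ← Multiset.singleton_add, colours_add,
              colours_eq_zero.2 hw0, add_zero]
            refine colours_congr h0 ?_
            simp [hR _ _ h1, hb]

/-- The answer of tokens `r` coloured by `κ'` to a transition `t` on tokens coloured by `κ`. -/
def Answer (N : PTNet P A) (τ : A) (κ κ' : Option P → K) (t : Transition P A)
    (r : Multiset (Option P)) : Prop :=
  (t.label = τ ∧ t.pre.card = 1 ∧ colours κ t.post = colours κ t.pre) ∨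
    ∃ t₂ ∈ N.trans, t.label = t₂.label ∧ colours κ t.post = colours κ' t₂.post ∧
      Multiset.Rel (fun x z' => ∃ z, x = some z ∧ ReflTransGen (TokStep N τ κ') z z') r t₂.pre

/-- An answer by intermediate tokens is passed one edge further: first their silent paths are
imitated, then their final transition `t₂` is transferred. If `t` needs no answer, or `t₂` can be
matched by silent paths alone, then `t` is a colour-preserving silent move. -/
theorem answer_comp {N : PTNet P A} {τ : A} {R V : Option P → Option P → Prop}
    (h : IsBranchingDPlaceBisim N τ R) {κ₀ κ κ' : Option P → K} (h₀ : κ₀ none = κ none)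
    (h0 : κ none = κ' none) (hR : ∀ x y, R x y → κ x = κ' y) (hV : ∀ x y, V x y → κ₀ x = κ y)
    {t : Transition P A}
    (hans : ∀ y, Multiset.Rel (fun a x => V (some a) x) t.pre y → Answer N τ κ₀ κ t y)
    {r : Multiset (Option P)} (hr : Multiset.Rel (fun a x => Relation.Comp V R (some a) x) t.pre r) :
    Answer N τ κ₀ κ' t r := by
  obtain ⟨y, hy₁, hy₂⟩ := hr.exists_mid fun a c hac => hac
  rcases hans y hy₁ with hi | ⟨t₂, ht₂, hl, hc, hrel⟩
  · exact Or.inl hi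
  have hpre : colours κ₀ t.pre = colours κ t₂.pre := by
    refine colours_eq_of_rel h₀ ((hy₁.comp hrel).imp ?_)
    rintro a b ⟨x, hax, z, rfl, hz⟩
    rw [TokStep.colour_eq hz, hV _ _ hax]
  have h3 := (Multiset.rel_flip.2 hy₂).comp hrel
  -- `r'` holds the positions of the partners after the imitated paths, with `none` if the followed
  -- token became related to $\theta$. The transfer of `t₂` then shows that `none` does not occur.
  obtain ⟨r', hr₁, hr₂⟩ := h3.exists_mid
    (p := fun x x' => x' = none ∨ ∃ z z', x = some z ∧ x' = some z' ∧
      ReflTransGen (TokStep N τ κ') z z')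
    (q := fun x' b => R (some b) x') (by
      rintro x b ⟨c, hc, z, rfl, hz⟩
      rcases h.transfer_path h0 hR hc hz with h4 | ⟨z, z', rfl, h4, h5⟩
      · exact ⟨none, Or.inl rfl, h4⟩
      · exact ⟨some z', Or.inr ⟨z, z', rfl, rfl, h4⟩, h5⟩)
  obtain ⟨q, rfl, hq⟩ := h.transfer hR ht₂ (Multiset.rel_flip.1 hr₂)
  have hrq : Multiset.Rel (fun x z' => ∃ z, x = some z ∧ ReflTransGen (TokStep N τ κ') z z') r q := by
    refine (Multiset.rel_map_right.1 hr₁).imp ?_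
    rintro x b (h4 | ⟨z, z', rfl, h4, h5⟩)
    · cases h4
    · cases h4
      exact ⟨z, rfl, h5⟩
  have hrq' : ∀ u : Multiset P, Multiset.Rel (ReflTransGen (TokStep N τ κ')) q u →
      Multiset.Rel (fun x z' => ∃ z, x = some z ∧ ReflTransGen (TokStep N τ κ') z z') r u := by
    intro u hu
    refine (hrq.comp hu).imp ?_
    rintro x b ⟨c, ⟨z, rfl, hz⟩, hc⟩
    exact ⟨z, rfl, hz.trans hc⟩
  rcases hq with ⟨⟨hτ, -, hcard⟩, y', hy', hpost⟩ | ⟨t₃, ht₃, hl', hd, hrel₃⟩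
  · refine Or.inl ⟨hl.trans hτ, ?_, ?_⟩
    · rw [Multiset.card_eq_card_of_rel hy₁, Multiset.card_eq_card_of_rel hrel, hcard]
    · rw [hc, hpre, colours_eq_of_rel h0 (hpost.imp fun a b => hR _ _)]
      have h5 : colours κ' q = colours κ' y' :=
        colours_eq_of_rel rfl (hy'.imp fun a b hab => (TokStep.colour_eq hab).symm)
      rw [← h5]
      refine (colours_eq_of_rel h0 ?_).symm
      exact (Multiset.rel_map_right.1 (Multiset.rel_flip.1 hr₂)).imp fun a b hab => hR _ _ hab
  · exact Or.inr ⟨t₃, ht₃, hl.trans hl', hc.trans (hd.colours_eq h0 hR), hrq' _ hrel₃⟩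

end Transfer

/-! ### Components of the bipartite graph and walks of equal length -/

section Sides

variable {P A : Type*}

/-- The edges of the bipartite graph of `R`, on two disjoint copies of `S ∪ {θ}`. -/
inductive SideEdge (R : Option P → Option P → Prop) : Bool × Option P → Bool × Option P → Prop
  | rel {x y : Option P} : R x y → SideEdge R (false, x) (true, y)

/-- The colour of `x` on a given side: its component in the bipartite graph of `R`. -/
def sideColour (R : Option P → Option P → Prop) (b : Bool) (x : Option P) : Quot (SideEdge R) :=
  Quot.mk _ (b, x)

/-- `R`, read from the given side. -/
def sideRel (R : Option P → Option P → Prop) : Bool → Option P → Option P → Prop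
  | false => R
  | true => flip R

/-- The side on which a walk of given length ends. -/
def endSide (b : Bool) : ℕ → Bool
  | 0 => b
  | n + 1 => !endSide b n

/-- Walks of given length in the bipartite graph of `R`. -/
def Chain (R : Option P → Option P → Prop) (b : Bool) : ℕ → Option P → Option P → Prop
  | 0 => Eq
  | n + 1 => Relation.Comp (Chain R b n) (sideRel R (endSide b n))

theorem sideRel_not {R : Option P → Option P → Prop} {b : Bool} {x y : Option P} :
    sideRel R (!b) x y ↔ sideRel R b y x := by
  cases b <;> rfl

theorem sideColour_eq {R : Option P → Option P → Prop} {b : Bool} {x y : Option P}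
    (h : sideRel R b x y) : sideColour R b x = sideColour R (!b) y := by
  cases b
  · exact Quot.sound (SideEdge.rel h)
  · exact (Quot.sound (SideEdge.rel (R := R) h)).symm

theorem sideRel_none {R : Option P → Option P → Prop} (h : R none none) (b : Bool) :
    sideRel R b none none := by cases b <;> exact h

theorem sideColour_none {R : Option P → Option P → Prop} (h : R none none) (b b' : Bool) :
    sideColour R b none = sideColour R b' none := by
  have := sideColour_eq (sideRel_none h b)
  cases b <;> cases b' <;> first | rfl | exact this

theorem Chain.sideColour_eq {R : Option P → Option P → Prop} {b : Bool} {n : ℕ} {x y : Option P}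
    (h : Chain R b n x y) : sideColour R b x = sideColour R (endSide b n) y := by
  induction n generalizing y with
  | zero => cases h; rfl
  | succ n ih =>
    obtain ⟨z, hz, hy⟩ := h
    rw [ih hz, PetriNet.sideColour_eq hy]
    rfl

/-- The last edge can be walked back and forth once more. -/
theorem Chain.add_two {R : Option P → Option P → Prop} {b : Bool} {n : ℕ} {x y : Option P}
    (h : Chain R b (n + 1) x y) : Chain R b (n + 3) x y := by
  obtain ⟨z, hz, hy⟩ := h
  refine ⟨z, ⟨y, ⟨z, hz, hy⟩, sideRel_not.2 hy⟩, ?_⟩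
  simpa [endSide] using hy

theorem Chain.mono {R : Option P → Option P → Prop} {b : Bool} {k l : ℕ} (hkl : k ≤ l)
    {x y : Option P} (h : Chain R b (2 * k + 1) x y) : Chain R b (2 * l + 1) x y := by
  induction l, hkl using Nat.le_induction with
  | base => exact h
  | succ l _ ih => exact ih.add_two

theorem endSide_two_mul (b : Bool) (k : ℕ) : endSide b (2 * k) = b := by
  induction k with
  | zero => rfl
  | succ k ih =>
    change (!!endSide b (2 * k)) = b
    rw [ih, Bool.not_not]

/-- Being in one component means being joined by a walk; it ends on the opposite side, so its length
is odd. -/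
theorem exists_chain {R : Option P → Option P → Prop} {b : Bool} {x y : Option P}
    (h : sideColour R b x = sideColour R (!b) y) : ∃ k, Chain R b (2 * k + 1) x y := by
  have h := Quot.eqvGen_exact h
  rw [← Relation.EqvGen.eqvGen_symmGen, Relation.EqvGen.eqvGen_eq_reflTransGen] at h
  have key : ∀ p, ReflTransGen (Relation.SymmGen (SideEdge R)) (b, x) p →
      ∃ n, endSide b n = p.1 ∧ Chain R b n x p.2 := by
    intro p hp
    induction hp with
    | refl => exact ⟨0, rfl, rfl⟩
    | @tail p q _ hs ih =>
      obtain ⟨n, hn, hc⟩ := ih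
      rcases hs with hs | hs <;> obtain ⟨hs⟩ := hs
      · refine ⟨n + 1, by simp [endSide, hn], _, hc, ?_⟩
        rw [hn]
        exact hs
      · refine ⟨n + 1, by simp [endSide, hn], _, hc, ?_⟩
        rw [hn]
        exact hs
  obtain ⟨n, hn, hc⟩ := key _ h
  rcases Nat.even_or_odd' n with ⟨k, rfl | rfl⟩
  · rw [endSide_two_mul] at hn
    simp at hn
  · exact ⟨k, hc⟩

/-- A common length is needed so that all tokens cross edges simultaneously and in the same
direction, by $R$ or by its converse. -/
theorem exists_rel_chain {R : Option P → Option P → Prop} {b : Bool} {m : Multiset P}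
    {r : Multiset (Option P)}
    (h : Multiset.Rel (fun a x => sideColour R b (some a) = sideColour R (!b) x) m r) :
    ∃ k, Multiset.Rel (fun a x => Chain R b (2 * k + 1) (some a) x) m r := by
  induction h with
  | zero => exact ⟨0, Multiset.Rel.zero⟩
  | cons hax _ ih =>
    obtain ⟨k, hk⟩ := exists_chain hax
    obtain ⟨l, hl⟩ := ih
    exact ⟨max k l, Multiset.Rel.cons (hk.mono (le_max_left _ _))
      (hl.imp fun _ _ h => h.mono (le_max_right _ _))⟩

theorem IsBranchingDPlaceBisim.sideRel {N : PTNet P A} {τ : A} {R : Option P → Option P → Prop}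
    (h : IsBranchingDPlaceBisim N τ R) (b : Bool) :
    IsBranchingDPlaceBisim N τ (sideRel R b) := by
  cases b
  · exact h
  · exact h.flip

/-- Induction on the length: walks of length zero are answered by `t` itself, and each further edge
is an instance of `answer_comp`. -/
theorem IsBranchingDPlaceBisim.answer_chain {N : PTNet P A} {τ : A}
    {R : Option P → Option P → Prop} (h : IsBranchingDPlaceBisim N τ R) (h0 : R none none)
    (b : Bool) (n : ℕ) {t : Transition P A} (ht : t ∈ N.trans) {r : Multiset (Option P)}
    (hr : Multiset.Rel (fun a x => Chain R b n (some a) x) t.pre r) :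
    Answer N τ (sideColour R b) (sideColour R (endSide b n)) t r := by
  induction n generalizing r with
  | zero =>
    refine Or.inr ⟨t, ht, rfl, rfl, ?_⟩
    exact Multiset.rel_flip.1 (hr.imp fun a x hax => ⟨a, hax.symm, ReflTransGen.refl⟩)
  | succ n ih =>
    exact answer_comp (h.sideRel (endSide b n)) (sideColour_none h0 _ _) (sideColour_none h0 _ _)
      (fun x y => PetriNet.sideColour_eq) (fun x y => Chain.sideColour_eq) (fun y => ih) hr

theorem IsBranchingDPlaceBisim.answer {N : PTNet P A} {τ : A}
    {R : Option P → Option P → Prop} (h : IsBranchingDPlaceBisim N τ R) (h0 : R none none)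
    (b : Bool) {t : Transition P A} (ht : t ∈ N.trans) {r : Multiset (Option P)}
    (hr : Multiset.Rel (fun a x => sideColour R b (some a) = sideColour R (!b) x) t.pre r) :
    Answer N τ (sideColour R b) (sideColour R (!b)) t r := by
  obtain ⟨k, hk⟩ := exists_rel_chain hr
  have := h.answer_chain h0 b (2 * k + 1) ht hk
  rwa [endSide, endSide_two_mul] at this

end Sides

/-! ### Extending causal nets by an event -/

section CausalNets

variable {X A : Type*}

theorem nodup_maxC (C : MarkedNet X A) : (maxC C).Nodup := Finset.nodup _

theorem mem_maxC {C : MarkedNet X A} {b : X} :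
    b ∈ maxC C ↔ b ∈ C.places ∧ ∀ e ∈ C.trans, b ∉ e.pre := by
  simp [maxC, PTNet.postOf, Finset.filter_eq_empty_iff]

/-- A node of the net `C`. -/
def IsNode (C : MarkedNet X A) : X ⊕ Transition X A → Prop :=
  Sum.elim (· ∈ C.places) (· ∈ C.trans)

/-- The net `C` with a further event `e`. -/
noncomputable def addEvent (C : MarkedNet X A) (e : Transition X A) (hpre : e.pre ≤ maxC C)
    (h0 : e.pre ≠ 0) (hl : e.label ∈ C.labels) : MarkedNet X A where
  places := C.places ∪ e.post.toFinset
  labels := C.labels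
  trans := insert e C.trans
  pre_ne_zero := by simpa [h0] using C.pre_ne_zero
  pre_subset := by
    simp only [Finset.mem_insert, forall_eq_or_imp, Finset.mem_union]
    exact ⟨fun s hs => Or.inl (mem_maxC.1 (Multiset.mem_of_le hpre hs)).1,
      fun t ht s hs => Or.inl (C.pre_subset t ht s hs)⟩
  post_subset := by
    simp only [Finset.mem_insert, forall_eq_or_imp, Finset.mem_union, Multiset.mem_toFinset]
    exact ⟨fun s hs => Or.inr hs, fun t ht s hs => Or.inl (C.post_subset t ht s hs)⟩
  label_mem := by simpa [hl] using C.label_mem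
  initial := C.initial
  initial_subset s hs := Finset.mem_union_left _ (C.initial_subset s hs)

section Extension

variable {C C' : MarkedNet X A} {e : Transition X A}

theorem notMem_trans_of_pre_le (hC' : e.pre ≠ 0) (hpre : e.pre ≤ maxC C) : e ∉ C.trans := by
  intro he
  obtain ⟨b, hb⟩ := Multiset.exists_mem_of_ne_zero hC'
  exact (mem_maxC.1 (Multiset.mem_of_le hpre hb)).2 e he hb

/-- The new event only produces new conditions, so no arc leads from a new node to an old one: old
nodes have old predecessors. -/
theorem flow_of_isNode (ht : C'.trans = insert e C.trans) (hpost : ∀ b ∈ e.post, b ∉ C.places)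
    {x y : X ⊕ Transition X A} (h : Flow C'.toPTNet x y) (hy : IsNode C y) :
    Flow C.toPTNet x y ∧ IsNode C x := by
  cases h with
  | pre he hb => exact ⟨Flow.pre hy hb, C.pre_subset _ hy _ hb⟩
  | post he hb =>
    rw [ht, Finset.mem_insert] at he
    rcases he with rfl | he
    · exact absurd hy (hpost _ hb)
    · exact ⟨Flow.post he hb, he⟩

theorem flow_mono (ht : C'.trans = insert e C.trans) {x y : X ⊕ Transition X A}
    (h : Flow C.toPTNet x y) : Flow C'.toPTNet x y := by
  cases h with
  | pre he hb => exact Flow.pre (by rw [ht]; exact Finset.mem_insert_of_mem he) hb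
  | post he hb => exact Flow.post (by rw [ht]; exact Finset.mem_insert_of_mem he) hb

theorem reflTransGen_flow_of_isNode (ht : C'.trans = insert e C.trans)
    (hpost : ∀ b ∈ e.post, b ∉ C.places) {x y : X ⊕ Transition X A}
    (h : ReflTransGen (Flow C'.toPTNet) x y) (hy : IsNode C y) :
    ReflTransGen (Flow C.toPTNet) x y ∧ IsNode C x := by
  induction h using ReflTransGen.head_induction_on with
  | refl => exact ⟨ReflTransGen.refl, hy⟩
  | head hs _ ih =>
    have := flow_of_isNode ht hpost hs ih.2
    exact ⟨ih.1.head this.1, this.2⟩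

theorem transGen_flow_of_isNode (ht : C'.trans = insert e C.trans)
    (hpost : ∀ b ∈ e.post, b ∉ C.places) {x y : X ⊕ Transition X A}
    (h : TransGen (Flow C'.toPTNet) x y) (hy : IsNode C y) :
    TransGen (Flow C.toPTNet) x y ∧ IsNode C x := by
  induction h using TransGen.head_induction_on with
  | single hs =>
    have := flow_of_isNode ht hpost hs hy
    exact ⟨TransGen.single this.1, this.2⟩
  | head hs _ ih =>
    have := flow_of_isNode ht hpost hs ih.2
    exact ⟨ih.1.head this.1, this.2⟩

theorem not_flow_of_mem_post (ht : C'.trans = insert e C.trans) (hpre : e.pre ≤ maxC C)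
    (hpost : ∀ b ∈ e.post, b ∉ C.places) {b : X} (hb : b ∈ e.post) {y : X ⊕ Transition X A} :
    ¬ Flow C'.toPTNet (.inl b) y := by
  rintro (⟨he, hb'⟩ | _)
  rw [ht, Finset.mem_insert] at he
  rcases he with rfl | he
  · exact hpost _ hb (mem_maxC.1 (Multiset.mem_of_le hpre hb')).1
  · exact hpost _ hb (C.pre_subset _ he _ hb')

/-- A cycle through an old node would lie in the old net. A cycle through new nodes only would have
to leave a new condition, which no event consumes. -/
theorem acyclic_of_insert (hC : Acyclic C.toPTNet) (ht : C'.trans = insert e C.trans)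
    (hpre : e.pre ≤ maxC C) (hpost : ∀ b ∈ e.post, b ∉ C.places) : Acyclic C'.toPTNet := by
  intro x hx
  by_cases hn : IsNode C x
  · exact hC x (transGen_flow_of_isNode ht hpost hx hn).1
  · obtain ⟨y, hxy, hyx⟩ := TransGen.head'_iff.1 hx
    cases hxy with
    | @pre b d hd hb =>
      rw [ht, Finset.mem_insert] at hd
      rcases hd with rfl | hd
      · exact hn (mem_maxC.1 (Multiset.mem_of_le hpre hb)).1
      · exact hn (C.pre_subset _ hd _ hb)
    | @post b d hd hb =>
      rw [ht, Finset.mem_insert] at hd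
      rcases hd with rfl | hd
      · rcases ReflTransGen.cases_head hyx with h | ⟨z, hz, -⟩
        · cases h
        · exact not_flow_of_mem_post ht hpre hpost hb hz
      · exact hn hd

end Extension

theorem IsCausal.addEvent {C : MarkedNet X A} (hC : IsCausal C) {e : Transition X A}
    (hpre : e.pre ≤ maxC C) (h0 : e.pre ≠ 0) (hl : e.label ∈ C.labels) (hnd : e.post.Nodup)
    (hpost : ∀ b ∈ e.post, b ∉ C.places) : IsCausal (addEvent C e hpre h0 hl) where
  acyclic := acyclic_of_insert (C := C) (e := e) hC.acyclic rfl hpre hpost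
  unbranched b hb := by
    have hb : b ∈ C.places ∪ e.post.toFinset := hb
    have hne := notMem_trans_of_pre_le h0 hpre
    by_cases hbC : b ∈ C.places
    · have := hC.unbranched b hbC
      constructor
      · have h1 : (PetriNet.addEvent C e hpre h0 hl).preOf b = C.preOf b := by
          ext d
          simp only [PTNet.preOf, PetriNet.addEvent, Finset.mem_filter, Finset.mem_insert]
          constructor
          · rintro ⟨rfl | hd, hd'⟩
            · exact absurd hbC (hpost b hd')
            · exact ⟨hd, hd'⟩
          · rintro ⟨hd, hd'⟩
            exact ⟨Or.inr hd, hd'⟩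
        rw [h1]
        exact this.1
      · by_cases hbe : b ∈ e.pre
        · rw [Finset.card_le_one]
          have h2 : ∀ d ∈ (PetriNet.addEvent C e hpre h0 hl).postOf b, d = e := by
            intro d hd
            simp only [PTNet.postOf, PetriNet.addEvent, Finset.mem_filter, Finset.mem_insert] at hd
            rcases hd with ⟨rfl | hd, hd'⟩
            · rfl
            · exact absurd hd' ((mem_maxC.1 (Multiset.mem_of_le hpre hbe)).2 d hd)
          intro d hd d' hd'
          rw [h2 d hd, h2 d' hd']
        · refine (Finset.card_le_card ?_).trans this.2
          intro d hd
          simp only [PTNet.postOf, PetriNet.addEvent, Finset.mem_filter, Finset.mem_insert] at hd ⊢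
          rcases hd with ⟨rfl | hd, hd'⟩
          · exact absurd hd' hbe
          · exact ⟨hd, hd'⟩
    · constructor
      · rw [Finset.card_le_one]
        have h2 : ∀ d ∈ (PetriNet.addEvent C e hpre h0 hl).preOf b, d = e := by
          intro d hd
          simp only [PTNet.preOf, PetriNet.addEvent, Finset.mem_filter, Finset.mem_insert] at hd
          rcases hd with ⟨rfl | hd, hd'⟩
          · rfl
          · exact absurd (C.post_subset d hd b hd') hbC
        intro d hd d' hd'
        rw [h2 d hd, h2 d' hd']
      · rw [Nat.le_one_iff_eq_zero_or_eq_one, Finset.card_eq_zero]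
        left
        rw [PTNet.postOf, Finset.filter_eq_empty_iff]
        intro d hd hbd
        rcases Finset.mem_insert.1 hd with rfl | hd
        · exact hbC (mem_maxC.1 (Multiset.mem_of_le hpre hbd)).1
        · exact hbC (C.pre_subset d hd b hbd)
  initial_count b hb := by
    change C.initial.count b = _
    have hb : b ∈ C.places ∪ e.post.toFinset := hb
    have h1 : (PetriNet.addEvent C e hpre h0 hl).preOf b = ∅ ↔ C.preOf b = ∅ ∧ b ∉ e.post := by
      simp only [PTNet.preOf, PetriNet.addEvent, Finset.filter_eq_empty_iff, Finset.mem_insert,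
        forall_eq_or_imp]
      exact and_comm
    by_cases hbC : b ∈ C.places
    · rw [hC.initial_count b hbC]
      have : b ∉ e.post := fun h => hpost b h hbC
      simp only [h1, this, not_false_iff, and_true]
    · have hbe : b ∈ e.post := by simpa [hbC] using hb
      rw [if_neg (fun h => (h1.1 h).2 hbe), Multiset.count_eq_zero]
      exact fun h => hbC (C.initial_subset b h)
  weight_one d hd b := by
    rcases Finset.mem_insert.1 hd with rfl | hd
    · exact ⟨Multiset.nodup_iff_count_le_one.1 (Multiset.nodup_of_le hpre (nodup_maxC C)) b,
        Multiset.nodup_iff_count_le_one.1 hnd b⟩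
    · exact hC.weight_one d hd b

/-! ### Causal order, observable pasts and event isomorphisms after a move -/

section Move

variable {C C' : MarkedNet X A} {e : Transition X A}

theorem CausalMove.pre_le (h : CausalMove C e C') : e.pre ≤ maxC C := h.2.2.2.2.1

theorem CausalMove.trans_eq (h : CausalMove C e C') : C'.trans = insert e C.trans := h.2.2.2.2.2.1

theorem CausalMove.places_eq (h : CausalMove C e C') : C'.places = C.places ∪ e.post.toFinset :=
  h.2.2.2.2.2.2

theorem CausalMove.mem_trans (h : CausalMove C e C') : e ∈ C'.trans := by
  rw [h.trans_eq]
  exact Finset.mem_insert_self _ _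

theorem CausalMove.notMem_trans (h : CausalMove C e C') : e ∉ C.trans :=
  notMem_trans_of_pre_le (C'.pre_ne_zero e h.mem_trans) h.pre_le

/-- Freshness follows from causality of both nets: an old condition without producer is initial and
may not acquire one, since the initial marking is unchanged; one with a producer may not acquire a
second. -/
theorem CausalMove.notMem_places (h : CausalMove C e C') : ∀ b ∈ e.post, b ∉ C.places := by
  intro b hb hbC
  obtain ⟨hC, hC', -, hi, -⟩ := id h
  have hb' : b ∈ C'.places := by rw [h.places_eq]; exact Finset.mem_union_left _ hbC
  have he : e ∈ C'.preOf b := Finset.mem_filter.2 ⟨h.mem_trans, hb⟩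
  by_cases h0 : C.preOf b = ∅
  · have h1 := hC.initial_count b hbC
    have h2 := hC'.initial_count b hb'
    rw [if_pos h0] at h1
    rw [if_neg (Finset.ne_empty_of_mem he), hi, h1] at h2
    cases h2
  · obtain ⟨d, hd⟩ := Finset.nonempty_iff_ne_empty.2 h0
    obtain ⟨hd, hd'⟩ := Finset.mem_filter.1 hd
    have hd'' : d ∈ C'.preOf b :=
      Finset.mem_filter.2 ⟨by rw [h.trans_eq]; exact Finset.mem_insert_of_mem hd, hd'⟩
    have := Finset.card_le_one.1 (hC'.unbranched b hb').1 e he d hd''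
    subst this
    exact h.notMem_trans hd

theorem CausalMove.nodup_post (h : CausalMove C e C') : e.post.Nodup :=
  Multiset.nodup_iff_count_le_one.2 fun b => (h.2.1.weight_one e h.mem_trans b).2

theorem CausalMove.maxC_eq (h : CausalMove C e C') : maxC C' = maxC C - e.pre + e.post := by
  have hnd : (maxC C - e.pre).Nodup := Multiset.nodup_of_le tsub_le_self (nodup_maxC C)
  have hnd' : (maxC C - e.pre + e.post).Nodup := by
    refine (Multiset.nodup_add).2 ⟨hnd, h.nodup_post, ?_⟩
    rw [Multiset.disjoint_right]
    intro b hb hb'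
    exact h.notMem_places b hb (mem_maxC.1 (Multiset.mem_of_le tsub_le_self hb')).1
  rw [Multiset.Nodup.ext (nodup_maxC C') hnd']
  intro b
  rw [Multiset.mem_add, Multiset.mem_sub_of_nodup (nodup_maxC C), mem_maxC, mem_maxC, h.trans_eq,
    h.places_eq]
  simp only [Finset.mem_union, Multiset.mem_toFinset, Finset.mem_insert, forall_eq_or_imp]
  constructor
  · rintro ⟨hb | hb, h1, h2⟩
    · exact Or.inl ⟨⟨hb, h2⟩, h1⟩
    · exact Or.inr hb
  · rintro (⟨⟨h1, h2⟩, h3⟩ | hb)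
    · exact ⟨Or.inl h1, h3, h2⟩
    · refine ⟨Or.inr hb, fun hb' => ?_, fun d hd hb' => ?_⟩
      · exact h.notMem_places b hb (mem_maxC.1 (Multiset.mem_of_le h.pre_le hb')).1
      · exact h.notMem_places b hb (C.pre_subset d hd b hb')

theorem CausalMove.reflTransGen_iff (h : CausalMove C e C') {x y : X ⊕ Transition X A}
    (hy : IsNode C y) :
    ReflTransGen (Flow C'.toPTNet) x y ↔ ReflTransGen (Flow C.toPTNet) x y :=
  ⟨fun hxy => (reflTransGen_flow_of_isNode h.trans_eq h.notMem_places hxy hy).1,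
    ReflTransGen.mono (fun _ _ => flow_mono h.trans_eq) _ _⟩

theorem CausalMove.not_eventLE (h : CausalMove C e C') {d : Transition X A} (hd : d ∈ C.trans) :
    ¬ EventLE C' e d := fun hed =>
  h.notMem_trans (reflTransGen_flow_of_isNode h.trans_eq h.notMem_places hed hd).2

theorem CausalMove.eventLE_iff (h : CausalMove C e C') {d d' : Transition X A}
    (hd : d' ∈ C.trans) : EventLE C' d d' ↔ EventLE C d d' :=
  h.reflTransGen_iff hd

theorem CausalMove.eventLE_new_iff (h : CausalMove C e C') {d : Transition X A} :
    EventLE C' d e ↔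
      d = e ∨ ∃ b ∈ e.pre, ReflTransGen (Flow C.toPTNet) (.inr d) (.inl b) := by
  constructor
  · intro hd
    rcases ReflTransGen.cases_tail hd with hd | ⟨y, hy, hye⟩
    · cases hd
      exact Or.inl rfl
    · cases hye with
      | @pre b _ he hb =>
        exact Or.inr ⟨b, hb, (h.reflTransGen_iff (y := .inl b)
          (mem_maxC.1 (Multiset.mem_of_le h.pre_le hb)).1).1 hy⟩
  · rintro (rfl | ⟨b, hb, hd⟩)
    · exact ReflTransGen.refl
    · exact (ReflTransGen.mono (fun _ _ => flow_mono h.trans_eq) _ _ hd).tail (Flow.pre h.mem_trans hb)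

theorem CausalMove.reflTransGen_post_iff (h : CausalMove C e C') {d : Transition X A} {b : X}
    (hb : b ∈ e.post) :
    ReflTransGen (Flow C'.toPTNet) (.inr d) (.inl b) ↔ EventLE C' d e := by
  constructor
  · intro hd
    rcases ReflTransGen.cases_tail hd with hd | ⟨y, hy, hyb⟩
    · cases hd
    · cases hyb with
      | @post _ d' hd' hb' =>
        rw [h.trans_eq, Finset.mem_insert] at hd'
        rcases hd' with rfl | hd'
        · exact hy
        · exact absurd (C.post_subset _ hd' _ hb') (h.notMem_places b hb)
  · exact fun hd => hd.tail (Flow.post h.mem_trans hb)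

/-- The observable events below the condition `b`. -/
def past (τ : A) (C : MarkedNet X A) (b : X) : Set (Transition X A) :=
  {d | d ∈ obsEvents τ C ∧ ReflTransGen (Flow C.toPTNet) (.inr d) (.inl b)}

/-- The observable events below some condition in `s`, together with `e` if it is observable. -/
def pastAfter (τ : A) (C : MarkedNet X A) (s : Multiset X) (e : Transition X A) :
    Set (Transition X A) :=
  {d | (d = e ∧ e.label ≠ τ) ∨ ∃ b ∈ s, d ∈ past τ C b}

theorem CausalMove.obsEvents_eq (h : CausalMove C e C') (τ : A) :
    obsEvents τ C' = {d | d ∈ obsEvents τ C ∨ (d = e ∧ e.label ≠ τ)} := by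
  ext d
  simp only [obsEvents, h.trans_eq, Finset.mem_insert, Set.mem_ofPred_eq]
  constructor
  · rintro ⟨rfl | h1, h2⟩
    · exact Or.inr ⟨rfl, h2⟩
    · exact Or.inl ⟨h1, h2⟩
  · rintro (⟨h1, h2⟩ | ⟨rfl, h2⟩)
    · exact ⟨Or.inr h1, h2⟩
    · exact ⟨Or.inl rfl, h2⟩

theorem CausalMove.past_eq (h : CausalMove C e C') (τ : A) {b : X} (hb : b ∈ C.places) :
    past τ C' b = past τ C b := by
  ext d
  simp only [past, Set.mem_ofPred_eq, h.obsEvents_eq τ]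
  constructor
  · rintro ⟨hd, h2⟩
    have := reflTransGen_flow_of_isNode h.trans_eq h.notMem_places h2 hb
    refine ⟨hd.resolve_right ?_, this.1⟩
    rintro ⟨rfl, -⟩
    exact h.notMem_trans this.2
  · rintro ⟨h1, h2⟩
    exact ⟨Or.inl h1, (h.reflTransGen_iff (y := .inl b) hb).2 h2⟩

/-- All conditions produced by one event share one past. If the event is silent and consumes a
single condition, it is the past of that condition. -/
theorem CausalMove.past_post_eq (h : CausalMove C e C') (τ : A) {b : X} (hb : b ∈ e.post) :
    past τ C' b = pastAfter τ C e.pre e := by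
  ext d
  simp only [past, pastAfter, Set.mem_ofPred_eq, h.obsEvents_eq τ, h.reflTransGen_post_iff hb,
    h.eventLE_new_iff]
  constructor
  · rintro ⟨h1 | h1, rfl | ⟨c, hc, h2⟩⟩
    · exact absurd h1.1 h.notMem_trans
    · exact Or.inr ⟨c, hc, h1, h2⟩
    · exact Or.inl h1
    · exact Or.inl h1
  · rintro (⟨rfl, h1⟩ | ⟨c, hc, h1, h2⟩)
    · exact ⟨Or.inr ⟨rfl, h1⟩, Or.inl rfl⟩
    · exact ⟨Or.inl h1, Or.inr ⟨c, hc, h2⟩⟩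

theorem IsAbstractEventIso.swap {τ : A} {C₁ C₂ : MarkedNet X A}
    {g : Set (Transition X A × Transition X A)} (h : IsAbstractEventIso τ C₁ C₂ g) :
    IsAbstractEventIso τ C₂ C₁ (Prod.swap ⁻¹' g) where
  subset _ hp := ⟨(h.subset hp).2, (h.subset hp).1⟩
  existsUnique_right := h.existsUnique_left
  existsUnique_left := h.existsUnique_right
  label_eq e₁ e₂ he := (h.label_eq e₂ e₁ he).symm
  le_iff e₁ e₂ e₁' e₂' he he' := (h.le_iff e₂ e₁ e₂' e₁' he he').symm

theorem IsAbstractEventIso.silent_left {τ : A} {C₁ C₁' C₂ : MarkedNet X A}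
    {g : Set (Transition X A × Transition X A)} (h : IsAbstractEventIso τ C₁ C₂ g)
    (hm : CausalMove C₁ e C₁') (he : e.label = τ) : IsAbstractEventIso τ C₁' C₂ g := by
  have ho : obsEvents τ C₁' = obsEvents τ C₁ := by
    rw [hm.obsEvents_eq τ]
    simp [he]
  refine ⟨?_, ?_, ?_, h.label_eq, ?_⟩
  · rw [ho]; exact h.subset
  · rw [ho]; exact h.existsUnique_right
  · exact h.existsUnique_left
  · intro e₁ e₂ e₁' e₂' h1 h2
    rw [hm.eventLE_iff (h.subset h2).1.1]
    exact h.le_iff _ _ _ _ h1 h2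

theorem IsAbstractEventIso.silent_right {τ : A} {C₁ C₂ C₂' : MarkedNet X A}
    {g : Set (Transition X A × Transition X A)} (h : IsAbstractEventIso τ C₁ C₂ g)
    (hm : CausalMove C₂ e C₂') (he : e.label = τ) : IsAbstractEventIso τ C₁ C₂' g :=
  (h.swap.silent_left hm he).swap

/-- The new events precede no old ones, so the only order relations to compare are those from old
events to the new ones. The pasts of the consumed conditions determine these, hence `hp`. -/
theorem IsAbstractEventIso.insert {τ : A} {C₁ C₁' C₂ C₂' : MarkedNet X A}
    {e₁ e₂ : Transition X A} {g : Set (Transition X A × Transition X A)}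
    (h : IsAbstractEventIso τ C₁ C₂ g) (hm₁ : CausalMove C₁ e₁ C₁') (hm₂ : CausalMove C₂ e₂ C₂')
    (hl : e₁.label = e₂.label) (hτ : e₁.label ≠ τ)
    (hp : ∀ x y, (x, y) ∈ g → ((∃ b ∈ e₁.pre, x ∈ past τ C₁ b) ↔ ∃ b ∈ e₂.pre, y ∈ past τ C₂ b)) :
    IsAbstractEventIso τ C₁' C₂' (g ∪ {(e₁, e₂)}) := by
  have hn₁ : ∀ y, (e₁, y) ∉ g := fun y hy => hm₁.notMem_trans (h.subset hy).1.1
  have hn₂ : ∀ x, (x, e₂) ∉ g := fun x hx => hm₂.notMem_trans (h.subset hx).2.1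
  have hτ₂ : e₂.label ≠ τ := hl ▸ hτ
  have hle : ∀ x y, (x, y) ∈ g → (EventLE C₁' x e₁ ↔ EventLE C₂' y e₂) := by
    intro x y hxy
    have hs := h.subset hxy
    rw [hm₁.eventLE_new_iff, hm₂.eventLE_new_iff]
    have h1 : x ≠ e₁ := fun hx => hn₁ y (hx ▸ hxy)
    have h2 : y ≠ e₂ := fun hx => hn₂ x (hx ▸ hxy)
    have h3 := hp x y hxy
    simp only [past, Set.mem_ofPred_eq, hs.1, hs.2, true_and] at h3
    simp only [h1, h2, false_or, h3]
  refine ⟨?_, ?_, ?_, ?_, ?_⟩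
  · rintro ⟨x, y⟩ (hxy | hxy)
    · rw [Set.mem_prod, hm₁.obsEvents_eq, hm₂.obsEvents_eq]
      exact ⟨Or.inl (h.subset hxy).1, Or.inl (h.subset hxy).2⟩
    · cases hxy
      rw [Set.mem_prod, hm₁.obsEvents_eq, hm₂.obsEvents_eq]
      exact ⟨Or.inr ⟨rfl, hτ⟩, Or.inr ⟨rfl, hτ₂⟩⟩
  · intro x hx
    rw [hm₁.obsEvents_eq] at hx
    rcases hx with hx | ⟨rfl, -⟩
    · obtain ⟨y, hy, hu⟩ := h.existsUnique_right x hx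
      refine ⟨y, Or.inl hy, ?_⟩
      rintro z (hz | hz)
      · exact hu z hz
      · cases hz
        exact absurd hx.1 hm₁.notMem_trans
    · refine ⟨e₂, Or.inr rfl, ?_⟩
      rintro z (hz | hz)
      · exact absurd hz (hn₁ z)
      · cases hz
        rfl
  · intro x hx
    rw [hm₂.obsEvents_eq] at hx
    rcases hx with hx | ⟨rfl, -⟩
    · obtain ⟨y, hy, hu⟩ := h.existsUnique_left x hx
      refine ⟨y, Or.inl hy, ?_⟩
      rintro z (hz | hz)
      · exact hu z hz
      · cases hz
        exact absurd hx.1 hm₂.notMem_trans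
    · refine ⟨e₁, Or.inr rfl, ?_⟩
      rintro z (hz | hz)
      · exact absurd hz (hn₂ z)
      · cases hz
        rfl
  · rintro x y (hxy | hxy)
    · exact h.label_eq x y hxy
    · cases hxy
      exact hl
  · rintro x y x' y' (hxy | hxy) (hxy' | hxy')
    · rw [hm₁.eventLE_iff (h.subset hxy').1.1, hm₂.eventLE_iff (h.subset hxy').2.1]
      exact h.le_iff _ _ _ _ hxy hxy'
    · cases hxy'
      exact hle x y hxy
    · cases hxy
      exact iff_of_false (hm₁.not_eventLE (h.subset hxy').1.1) (hm₂.not_eventLE (h.subset hxy').2.1)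
    · cases hxy
      cases hxy'
      exact iff_of_true ReflTransGen.refl ReflTransGen.refl

end Move

end CausalNets

/-! ### Unfolding enabled transitions into processes -/

section Folding

variable {X P A : Type*}

theorem map_eq_map_some_filterMap {α β : Type*} {f : α → Option β} {m : Multiset α}
    (h : ∀ a ∈ m, (f a).isSome) : m.map f = (m.filterMap f).map some := by
  induction m using Multiset.induction_on with
  | empty => rfl
  | cons a m ih =>
    obtain ⟨b, hb⟩ := Option.isSome_iff_exists.1 (h a (Multiset.mem_cons_self a m))
    rw [Multiset.filterMap_cons_some f a m hb, Multiset.map_cons, Multiset.map_cons, hb,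
      ih fun x hx => h x (Multiset.mem_cons_of_mem hx)]

theorem filterMap_congr_of_mem {α β : Type*} {f g : α → Option β} {m : Multiset α}
    (h : ∀ a ∈ m, f a = g a) : m.filterMap f = m.filterMap g := by
  induction m using Quotient.inductionOn with
  | h l => exact congrArg _ (List.filterMap_congr h)

theorem filterMap_eq_of_map_eq {α β : Type*} {f : α → Option β} {m : Multiset α} {n : Multiset β}
    (h : m.map f = n.map some) : m.filterMap f = n := by
  refine Multiset.map_injective (Option.some_injective β) ?_
  rw [← h]
  refine (map_eq_map_some_filterMap fun a ha => ?_).symm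
  have : f a ∈ n.map some := h ▸ Multiset.mem_map_of_mem f ha
  obtain ⟨b, -, hb⟩ := Multiset.mem_map.1 this
  rw [← hb]
  rfl

/-- Fresh names, outside a given finite set, for the elements of a multiset. -/
theorem exists_fresh [Infinite X] (F : Finset X) (m : Multiset P) :
    ∃ (G : Finset X) (h : X → Option P), (∀ b ∈ G, b ∉ F) ∧ (∀ b, (h b).isSome ↔ b ∈ G) ∧
      G.val.map h = m.map some := by
  induction m using Multiset.induction_on with
  | empty => exact ⟨∅, fun _ => none, by simp, by simp, rfl⟩
  | cons s m ih =>
    obtain ⟨G, h, hF, hs, hm⟩ := ih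
    obtain ⟨x, hx⟩ := Infinite.exists_notMem_finset (F ∪ G)
    rw [Finset.mem_union, not_or] at hx
    refine ⟨Finset.cons x G hx.2, Function.update h x (some s), ?_, ?_, ?_⟩
    · intro b hb
      rcases Finset.mem_cons.1 hb with rfl | hb
      · exact hx.1
      · exact hF b hb
    · intro b
      rw [Finset.mem_cons]
      by_cases hb : b = x
      · subst hb
        simp
      · rw [Function.update_of_ne hb, hs]
        simp [hb]
    · rw [Finset.cons_val, Multiset.map_cons, Multiset.map_cons, Function.update_self, ← hm]
      congr 1
      refine Multiset.map_congr rfl fun b hb => Function.update_of_ne ?_ _ _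
      rintro rfl
      exact hx.2 hb

section

variable {N : PTNet P A} {m₀ : Multiset P} {π : NetProc X P A}

theorem IsProcess.isSome_of_mem (h : IsProcess N m₀ π) {s : Multiset X}
    (hs : ∀ b ∈ s, b ∈ π.net.places) : s.map π.onPlaces = (π.image s).map some :=
  map_eq_map_some_filterMap fun b hb => (h.dom_places b).2 (hs b hb)

theorem IsProcess.map_pre (h : IsProcess N m₀ π) {e : Transition X A} {t : Transition P A}
    (he : π.onTrans e = some t) : e.pre.map π.onPlaces = t.pre.map some := by
  have hmem : e ∈ π.net.trans := (h.dom_trans e).1 (by rw [he]; rfl)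
  rw [← h.pre_eq e t he]
  exact h.isSome_of_mem (π.net.pre_subset e hmem)

theorem IsProcess.map_post (h : IsProcess N m₀ π) {e : Transition X A} {t : Transition P A}
    (he : π.onTrans e = some t) : e.post.map π.onPlaces = t.post.map some := by
  have hmem : e ∈ π.net.trans := (h.dom_trans e).1 (by rw [he]; rfl)
  rw [← h.post_eq e t he]
  exact h.isSome_of_mem (π.net.post_subset e hmem)

/-- A transition that is enabled in a process can be appended to it. -/
theorem IsProcess.exists_procMove [Infinite X] (h : IsProcess N m₀ π) {s : Multiset X}
    (hs : s ≤ maxC π.net) {t : Transition P A} (ht : t ∈ N.trans)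
    (hst : s.map π.onPlaces = t.pre.map some) :
    ∃ e π', ProcMove N π e π' ∧ e.pre = s ∧ π'.onTrans e = some t := by
  obtain ⟨G, f, hG, hf, hmap⟩ := exists_fresh π.net.places t.post
  -- The event consumes exactly the prescribed conditions `s`, so the tokens used, and thereby the
  -- causes, can be chosen.
  let e : Transition X A := ⟨s, t.label, G.val⟩
  have hs0 : e.pre ≠ 0 := by
    rintro (h0 : s = 0)
    rw [h0, Multiset.map_zero, eq_comm, Multiset.map_eq_zero] at hst
    exact N.pre_ne_zero t ht hst
  have hl : e.label ∈ π.net.labels := by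
    rw [h.labels_eq]
    exact N.label_mem t ht
  have hpost : ∀ b ∈ e.post, b ∉ π.net.places := hG
  have hne : e ∉ π.net.trans := notMem_trans_of_pre_le hs0 hs
  let C' := addEvent π.net e hs hs0 hl
  have hC' : IsCausal C' := h.causal.addEvent hs hs0 hl G.nodup hpost
  let ρ : X → Option P := fun b => if b ∈ π.net.places then π.onPlaces b else f b
  have hρold : ∀ b ∈ π.net.places, ρ b = π.onPlaces b := fun b hb => if_pos hb
  have hρnew : ∀ b ∈ G, ρ b = f b := fun b hb => if_neg (hG b hb)
  let π' : NetProc X P A := ⟨C', ρ, fun d => if d = e then some t else π.onTrans d⟩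
  have himg : ∀ u : Multiset X, (∀ b ∈ u, b ∈ π.net.places) → π'.image u = π.image u :=
    fun u hu => filterMap_congr_of_mem fun b hb => hρold b (hu b hb)
  have hsub : ∀ b ∈ s, b ∈ π.net.places := fun b hb => (mem_maxC.1 (Multiset.mem_of_le hs hb)).1
  have hGmap : G.val.map ρ = t.post.map some := by
    rw [← hmap]
    exact Multiset.map_congr rfl hρnew
  have hold : ∀ d u, π.onTrans d = some u → π'.onTrans d = some u := by
    intro d u hd
    have : d ≠ e := by
      rintro rfl
      exact hne ((h.dom_trans _).1 (by rw [hd]; rfl))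
    exact (if_neg this).trans hd
  have hcase : ∀ d u, π'.onTrans d = some u → (d = e ∧ u = t) ∨ π.onTrans d = some u := by
    intro d u hd
    by_cases hde : d = e
    · left
      have : some t = some u := (if_pos hde).symm.trans hd
      exact ⟨hde, (Option.some_injective _ this).symm⟩
    · right
      exact (if_neg hde).symm.trans hd
  have hmem : ∀ d u, π.onTrans d = some u → d ∈ π.net.trans := fun d u hd =>
    (h.dom_trans d).1 (by rw [hd]; rfl)
  have hπ' : IsProcess N m₀ π' := by
    refine ⟨hC', ?_, ?_, ?_, ?_, h.labels_eq, ?_, ?_, ?_, ?_⟩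
    · intro b
      change (ρ b).isSome ↔ b ∈ π.net.places ∪ e.post.toFinset
      rw [Finset.mem_union, Multiset.mem_toFinset]
      by_cases hb : b ∈ π.net.places
      · rw [hρold b hb, h.dom_places]
        simp [hb]
      · have : ρ b = f b := if_neg hb
        rw [this, hf]
        simp [hb, e]
    · intro d
      change (if d = e then some t else π.onTrans d).isSome ↔ d ∈ insert e π.net.trans
      by_cases hd : d = e
      · simp [hd]
      · simp [hd, h.dom_trans]
    · intro b u hu
      by_cases hb : b ∈ π.net.places
      · exact h.map_places b u ((hρold b hb).symm.trans hu)
      · have hfb : f b = some u := (if_neg hb).symm.trans hu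
        have hbG : b ∈ G := (hf b).1 (by rw [hfb]; rfl)
        have : some u ∈ t.post.map some := hmap ▸ hfb ▸ Multiset.mem_map_of_mem f hbG
        obtain ⟨v, hv, hvu⟩ := Multiset.mem_map.1 this
        cases hvu
        exact N.post_subset t ht _ hv
    · intro d u hd
      rcases hcase d u hd with ⟨-, rfl⟩ | hd
      · exact ht
      · exact h.map_trans d u hd
    · intro d u hd
      rcases hcase d u hd with ⟨rfl, rfl⟩ | hd
      · rfl
      · exact h.label_eq d u hd
    · exact (himg _ π.net.initial_subset).trans h.initial_eq
    · intro d u hd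
      rcases hcase d u hd with ⟨rfl, rfl⟩ | hd
      · exact (himg s hsub).trans (filterMap_eq_of_map_eq hst)
      · exact (himg _ (π.net.pre_subset d (hmem d u hd))).trans (h.pre_eq d u hd)
    · intro d u hd
      rcases hcase d u hd with ⟨rfl, rfl⟩ | hd
      · exact filterMap_eq_of_map_eq hGmap
      · exact (himg _ (π.net.post_subset d (hmem d u hd))).trans (h.post_eq d u hd)
  refine ⟨e, π', ⟨⟨m₀, h, hπ'⟩, ⟨h.causal, hC', rfl, rfl, hs, rfl, rfl⟩, ?_, hold⟩, rfl, if_pos rfl⟩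
  intro b u hb
  exact (hρold b ((h.dom_places b).1 (by rw [hb]; rfl))).trans hb

end

/-- A marking of a net is the initial marking of a process without events. -/
theorem exists_initial_process [Infinite X] (N : PTNet P A) {m : Multiset P}
    (hm : ∀ s ∈ m, s ∈ N.places) :
    ∃ π : NetProc X P A, IsProcess N m π ∧ π.net.trans = ∅ ∧ π.net.initial = maxC π.net := by
  obtain ⟨G, f, -, hf, hmap⟩ := exists_fresh (∅ : Finset X) m
  let C : MarkedNet X A :=
    { places := G, labels := N.labels, trans := ∅, pre_ne_zero := by simp, pre_subset := by simp,
      post_subset := by simp, label_mem := by simp, initial := G.val,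
      initial_subset := fun s hs => hs }
  have hC : IsCausal C := by
    refine ⟨?_, ?_, ?_, ?_⟩
    · intro x hx
      obtain ⟨y, hxy, -⟩ := TransGen.head'_iff.1 hx
      cases hxy with
      | pre h _ => simp [C] at h
      | post h _ => simp [C] at h
    · simp [PTNet.preOf, PTNet.postOf, C]
    · intro b hb
      simp only [PTNet.preOf, C, Finset.filter_empty, if_true]
      exact Multiset.count_eq_one_of_mem G.nodup hb
    · simp [C]
  refine ⟨⟨C, f, fun _ => none⟩, ⟨hC, hf, by simp [C], ?_, by simp, rfl, by simp, ?_, by simp,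
    by simp⟩, rfl, ?_⟩
  · intro b s hbs
    have hbG : b ∈ G := (hf b).1 (by rw [show f b = some s from hbs]; rfl)
    have : some s ∈ m.map some := by
      rw [← hmap, ← show f b = some s from hbs]
      exact Multiset.mem_map_of_mem f hbG
    obtain ⟨v, hv, hvs⟩ := Multiset.mem_map.1 this
    cases hvs
    exact hm _ hv
  · exact filterMap_eq_of_map_eq hmap
  · simp [maxC, PTNet.postOf, C]

end Folding

/-! ### Coloured tokens with pasts, and silent extensions of processes -/

section Tokens

variable {X P A K : Type*}

/-- The colour and the observable past of a condition. -/
def tok (τ : A) (κ : Option P → K) (π : NetProc X P A) (b : X) : K × Set (Transition X A) :=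
  (κ (π.onPlaces b), past τ π.net b)

/-- The colours and pasts of those conditions that do not have the colour of `θ`. -/
noncomputable def toks (τ : A) (κ : Option P → K) (π : NetProc X P A) (s : Multiset X) :
    Multiset (K × Set (Transition X A)) :=
  (s.filter fun b => κ (π.onPlaces b) ≠ κ none).map (tok τ κ π)

theorem toks_add (τ : A) (κ : Option P → K) (π : NetProc X P A) (s u : Multiset X) :
    toks τ κ π (s + u) = toks τ κ π s + toks τ κ π u := by
  simp [toks]

theorem toks_eq_zero {τ : A} {κ : Option P → K} {π : NetProc X P A} {s : Multiset X}
    (h : ∀ b ∈ s, κ (π.onPlaces b) = κ none) : toks τ κ π s = 0 := by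
  simpa [toks, Multiset.filter_eq_nil] using h

theorem toks_eq_filter (τ : A) (κ : Option P → K) (π : NetProc X P A) (s : Multiset X) :
    toks τ κ π s = (s.map (tok τ κ π)).filter fun p => p.1 ≠ κ none := by
  rw [toks, Multiset.filter_map]
  rfl

theorem toks_congr {τ : A} {κ : Option P → K} {π π' : NetProc X P A} {s s' : Multiset X}
    (h : s.map (tok τ κ π) = s'.map (tok τ κ π')) : toks τ κ π s = toks τ κ π' s' := by
  rw [toks_eq_filter, toks_eq_filter, h]

theorem toks_eq_colours {τ : A} {κ : Option P → K} {π : NetProc X P A} {s : Multiset X}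
    {m : Multiset P} {S : Set (Transition X A)} (hm : s.map π.onPlaces = m.map some)
    (hS : ∀ b ∈ s, past τ π.net b = S) : toks τ κ π s = (colours κ m).map fun c => (c, S) := by
  have h1 : s.map (tok τ κ π) = (s.map π.onPlaces).map fun x => (κ x, S) := by
    rw [Multiset.map_map]
    exact Multiset.map_congr rfl fun b hb => Prod.ext rfl (hS b hb)
  rw [toks_eq_filter, h1, hm, Multiset.map_map, colours, Multiset.filter_map, Multiset.filter_map,
    Multiset.map_map]
  rfl

theorem past_of_mem_toks {τ : A} {κ : Option P → K} {π : NetProc X P A} {s : Multiset X}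
    {p : K × Set (Transition X A)} (h : p ∈ toks τ κ π s) {x : Transition X A} (hx : x ∈ p.2) :
    x ∈ π.net.trans := by
  obtain ⟨b, -, rfl⟩ := Multiset.mem_map.1 h
  exact hx.1.1

section Move

variable {N : PTNet P A} {π π' : NetProc X P A} {e : Transition X A}

theorem ProcMove.exists_trans (h : ProcMove N π e π') :
    ∃ t ∈ N.trans, π'.onTrans e = some t ∧ e.label = t.label := by
  obtain ⟨⟨m₀, -, hπ'⟩, hm, -⟩ := h
  obtain ⟨t, ht⟩ := Option.isSome_iff_exists.1 ((hπ'.dom_trans e).2 hm.mem_trans)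
  exact ⟨t, hπ'.map_trans e t ht, ht, hπ'.label_eq e t ht⟩

theorem ProcMove.onPlaces_eq (h : ProcMove N π e π') {b : X} (hb : b ∈ π.net.places) :
    π'.onPlaces b = π.onPlaces b := by
  obtain ⟨⟨m₀, hπ, -⟩, -, hρ, -⟩ := h
  obtain ⟨s, hs⟩ := Option.isSome_iff_exists.1 ((hπ.dom_places b).2 hb)
  rw [hs, hρ b s hs]

theorem ProcMove.tok_eq (h : ProcMove N π e π') (τ : A) (κ : Option P → K) {b : X}
    (hb : b ∈ π.net.places) : tok τ κ π' b = tok τ κ π b :=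
  Prod.ext (congrArg κ (h.onPlaces_eq hb)) (h.2.1.past_eq τ hb)

theorem ProcMove.map_pre (h : ProcMove N π e π') {t : Transition P A}
    (ht : π'.onTrans e = some t) : e.pre.map π.onPlaces = t.pre.map some := by
  obtain ⟨m₀, -, hπ'⟩ := h.1
  rw [← hπ'.map_pre ht]
  exact Multiset.map_congr rfl fun b hb =>
    (h.onPlaces_eq (mem_maxC.1 (Multiset.mem_of_le h.2.1.pre_le hb)).1).symm

/-- Unconsumed conditions keep colour and past; produced ones share a single past, so they
contribute only the colours of `t.post`. -/
theorem ProcMove.toks_maxC (h : ProcMove N π e π') (τ : A) (κ : Option P → K)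
    {t : Transition P A} (ht : π'.onTrans e = some t) :
    toks τ κ π' (maxC π'.net) = toks τ κ π (maxC π.net - e.pre) +
      (colours κ t.post).map fun c => (c, pastAfter τ π.net e.pre e) := by
  obtain ⟨m₀, -, hπ'⟩ := h.1
  rw [h.2.1.maxC_eq, toks_add,
    toks_eq_colours (hπ'.map_post ht) fun b hb => h.2.1.past_post_eq τ hb]
  congr 1
  refine toks_congr (Multiset.map_congr rfl fun b hb => h.tok_eq τ κ ?_)
  exact (mem_maxC.1 (Multiset.mem_of_le tsub_le_self hb)).1

end Move

/-- `π'` arises from `π` by silent moves. -/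
structure SilentExt (N : PTNet P A) (τ : A) (κ : Option P → K) (π π' : NetProc X P A) : Prop where
  moves : ∃ σ, obs τ σ = [] ∧ ProcMoves N π σ π'
  preserves : (∃ m₀, IsProcess N m₀ π) → ∃ m₀, IsProcess N m₀ π'
  places_subset : ∀ b ∈ π.net.places, b ∈ π'.net.places
  onPlaces_eq : ∀ b ∈ π.net.places, π'.onPlaces b = π.onPlaces b
  tok_eq : ∀ b ∈ π.net.places, tok τ κ π' b = tok τ κ π b
  iso : ∀ C g, IsAbstractEventIso τ C π.net g → IsAbstractEventIso τ C π'.net g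

theorem SilentExt.refl (N : PTNet P A) (τ : A) (κ : Option P → K) (π : NetProc X P A) :
    SilentExt N τ κ π π :=
  ⟨⟨[], rfl, ProcMoves.nil π⟩, id, fun _ => id, fun _ _ => rfl, fun _ _ => rfl, fun _ _ => id⟩

theorem SilentExt.head {N : PTNet P A} {τ : A} {κ : Option P → K} {π π' π'' : NetProc X P A}
    {e : Transition X A} (h : ProcMove N π e π') (he : e.label = τ)
    (h' : SilentExt N τ κ π' π'') : SilentExt N τ κ π π'' where
  moves := by
    obtain ⟨σ, hσ, hm⟩ := h'.moves
    exact ⟨e :: σ, by simp [obs, he, hσ], ProcMoves.cons h hm⟩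
  preserves _ := h'.preserves (by obtain ⟨m₀, -, hπ⟩ := h.1; exact ⟨m₀, hπ⟩)
  places_subset b hb := h'.places_subset b
    (by rw [h.2.1.places_eq]; exact Finset.mem_union_left _ hb)
  onPlaces_eq b hb := (h'.onPlaces_eq b
    (by rw [h.2.1.places_eq]; exact Finset.mem_union_left _ hb)).trans (h.onPlaces_eq hb)
  tok_eq b hb := (h'.tok_eq b
    (by rw [h.2.1.places_eq]; exact Finset.mem_union_left _ hb)).trans (h.tok_eq τ κ hb)
  iso C g hg := h'.iso C g (hg.silent_right h.2.1 he)

theorem ProcMoves.append {N : PTNet P A} {π π' π'' : NetProc X P A} {σ σ' : List (Transition X A)}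
    (h : ProcMoves N π σ π') (h' : ProcMoves N π' σ' π'') : ProcMoves N π (σ ++ σ') π'' := by
  induction h with
  | nil => exact h'
  | cons hm _ ih => exact ProcMoves.cons hm (ih h')

theorem obs_append (τ : A) (σ σ' : List (Transition P A)) :
    obs τ (σ ++ σ') = obs τ σ ++ obs τ σ' := by
  induction σ with
  | nil => rfl
  | cons t σ ih =>
    simp only [List.cons_append, obs, ih]
    split_ifs <;> rfl

theorem SilentExt.trans {N : PTNet P A} {τ : A} {κ : Option P → K} {π π' π'' : NetProc X P A}
    (h : SilentExt N τ κ π π') (h' : SilentExt N τ κ π' π'') : SilentExt N τ κ π π'' where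
  moves := by
    obtain ⟨σ, hσ, hm⟩ := h.moves
    obtain ⟨σ', hσ', hm'⟩ := h'.moves
    exact ⟨σ ++ σ', by rw [obs_append, hσ, hσ']; rfl, hm.append hm'⟩
  preserves hπ := h'.preserves (h.preserves hπ)
  places_subset b hb := h'.places_subset b (h.places_subset b hb)
  onPlaces_eq b hb := (h'.onPlaces_eq b (h.places_subset b hb)).trans (h.onPlaces_eq b hb)
  tok_eq b hb := (h'.tok_eq b (h.places_subset b hb)).trans (h.tok_eq b hb)
  iso C g hg := h'.iso C g (h.iso C g hg)

theorem mem_places_of_le_maxC {C : MarkedNet X A} {s : Multiset X} (hs : s ≤ maxC C) {b : X}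
    (hb : b ∈ s) : b ∈ C.places :=
  (mem_maxC.1 (Multiset.mem_of_le hs hb)).1

/-- Each step unfolds to a silent event consuming one condition, so the token inherits its
observable past along with its colour. The by-products gather in `G` and are invisible to `toks`. -/
theorem exists_silentExt_of_tokPath [Infinite X] {N : PTNet P A} {τ : A} {κ : Option P → K}
    {z z' : P} (hz : ReflTransGen (TokStep N τ κ) z z') {π : NetProc X P A}
    (hπ : ∃ m₀, IsProcess N m₀ π) {b : X} {s : Multiset X} (hb : maxC π.net = b ::ₘ s)
    (hbz : π.onPlaces b = some z) :
    ∃ π' b' G, SilentExt N τ κ π π' ∧ maxC π'.net = b' ::ₘ (s + G) ∧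
      π'.onPlaces b' = some z' ∧ tok τ κ π' b' = tok τ κ π b ∧
      ∀ x ∈ G, κ (π'.onPlaces x) = κ none := by
  induction hz using ReflTransGen.head_induction_on generalizing π b s with
  | refl => exact ⟨π, b, 0, SilentExt.refl N τ κ π, by rw [add_zero, hb], hbz, rfl, by simp⟩
  | @head z z₁ hs _ ih =>
    obtain ⟨u, hu, hτ, hpre, hκ, w, hw, hw0⟩ := hs
    obtain ⟨m₀, hπ⟩ := hπ
    obtain ⟨e, π₁, hm, hes, het⟩ := hπ.exists_procMove (s := {b}) (t := u)
      (by rw [hb]; simp) hu (by simp [hpre, hbz])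
    obtain ⟨m₁, -, hπ₁⟩ := hm.1
    have heτ : e.label = τ := (hπ₁.label_eq e u het).trans hτ
    have hpost := hπ₁.map_post het
    rw [hw, Multiset.map_cons, ← Multiset.map_eq_cons] at hpost
    obtain ⟨b₁, hb₁, hb₁z, hrest⟩ := hpost
    have hmax : maxC π₁.net = b₁ ::ₘ (s + e.post.erase b₁) := by
      rw [hm.2.1.maxC_eq, hb, hes, Multiset.sub_singleton, Multiset.erase_cons_head,
        ← Multiset.add_cons, Multiset.cons_erase hb₁]
    have htok : tok τ κ π₁ b₁ = tok τ κ π b := by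
      refine Prod.ext ?_ ?_
      · simp [tok, hb₁z, hbz, hκ]
      · have := hm.2.1.past_post_eq τ hb₁
        simp only [tok, this, pastAfter, hes]
        ext d
        simp [heτ]
    obtain ⟨π', b', G, hext, hmax', hb', htok', hG⟩ := ih ⟨m₁, hπ₁⟩ hmax hb₁z
    refine ⟨π', b', e.post.erase b₁ + G, SilentExt.head hm heτ hext, ?_, hb', htok'.trans htok, ?_⟩
    · rw [hmax', add_assoc]
    · intro x hx
      rcases Multiset.mem_add.1 hx with hx | hx
      · have hxp : x ∈ π₁.net.places := by
          have : x ∈ maxC π₁.net := by rw [hmax]; simp [hx]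
          exact (mem_maxC.1 this).1
        rw [hext.onPlaces_eq x hxp]
        have : π₁.onPlaces x ∈ w.map some := hrest ▸ Multiset.mem_map_of_mem _ hx
        obtain ⟨v, hv, hvx⟩ := Multiset.mem_map.1 this
        rw [← hvx]
        exact hw0 v hv
      · exact hG x hx

/-- The paths use disjoint tokens, so they can be unfolded one after another without disturbing the
other maximal conditions. -/
theorem exists_silentExt_of_rel [Infinite X] {N : PTNet P A} {τ : A} {κ : Option P → K}
    {q : Multiset X} {w : Multiset P} {π : NetProc X P A} (hπ : ∃ m₀, IsProcess N m₀ π)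
    {s : Multiset X} (hq : maxC π.net = q + s)
    (h : Multiset.Rel
      (fun b z' => ∃ z, π.onPlaces b = some z ∧ ReflTransGen (TokStep N τ κ) z z') q w) :
    ∃ π' q' G, SilentExt N τ κ π π' ∧ maxC π'.net = q' + (s + G) ∧
      q'.map π'.onPlaces = w.map some ∧ q'.map (tok τ κ π') = q.map (tok τ κ π) ∧
      ∀ x ∈ G, κ (π'.onPlaces x) = κ none := by
  induction q using Multiset.induction_on generalizing π s w with
  | empty =>
    rw [Multiset.rel_zero_left] at h
    subst h
    exact ⟨π, 0, 0, SilentExt.refl N τ κ π, by rw [add_zero, hq], rfl, rfl, by simp⟩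
  | cons b q ih =>
    obtain ⟨z', w', ⟨z, hbz, hz⟩, hrel, rfl⟩ := Multiset.rel_cons_left.1 h
    rw [Multiset.cons_add] at hq
    obtain ⟨π₁, b₁, G₁, hext₁, hmax₁, hb₁, htok₁, hG₁⟩ := exists_silentExt_of_tokPath hz hπ hq hbz
    have hplaces : ∀ x ∈ q, x ∈ π.net.places := fun x hx => by
      have : x ∈ maxC π.net := by rw [hq]; simp [hx]
      exact (mem_maxC.1 this).1
    have hplaces₁ : ∀ x, x ∈ b₁ ::ₘ (q + s + G₁) → x ∈ π₁.net.places := fun x hx => by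
      rw [← hmax₁] at hx
      exact (mem_maxC.1 hx).1
    -- The token already moved and its by-products join the conditions that stay idle.
    obtain ⟨π', q', G, hext, hmax, hq', htok, hG⟩ := ih (π := π₁) (s := b₁ ::ₘ (s + G₁)) (w := w')
      (hext₁.preserves hπ) (by rw [hmax₁, Multiset.add_cons, add_assoc])
      (hrel.mono fun x hx y _ => by rw [hext₁.onPlaces_eq x (hplaces x hx)]; exact id)
    have hb₁p : b₁ ∈ π₁.net.places := hplaces₁ b₁ (by simp)
    refine ⟨π', b₁ ::ₘ q', G₁ + G, hext₁.trans hext, ?_, ?_, ?_, ?_⟩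
    · rw [hmax, Multiset.cons_add, Multiset.cons_add, Multiset.add_cons, add_assoc s]
    · rw [Multiset.map_cons, Multiset.map_cons, hq', hext.onPlaces_eq b₁ hb₁p, hb₁]
    · rw [Multiset.map_cons, Multiset.map_cons, htok, hext.tok_eq b₁ hb₁p, htok₁]
      congr 1
      exact Multiset.map_congr rfl fun x hx => hext₁.tok_eq x (hplaces x hx)
    · intro x hx
      rcases Multiset.mem_add.1 hx with hx | hx
      · rw [hext.onPlaces_eq x (hplaces₁ x (by simp [hx]))]
        exact hG₁ x hx
      · exact hG x hx

end Tokens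

/-! ### The branching fc-bisimulation -/

section Simulation

variable {X P A K : Type*}

/-- Equal colours, and pasts that correspond along `g`. -/
def Compat (g : Set (Transition X A × Transition X A)) (p q : K × Set (Transition X A)) : Prop :=
  p.1 = q.1 ∧ ∀ x y, (x, y) ∈ g → (x ∈ p.2 ↔ y ∈ q.2)

/-- Two processes whose maximal conditions can be linked with respect to colours and pasts. -/
structure Linked (N : PTNet P A) (τ : A) (κ κ' : Option P → K) (π₁ : NetProc X P A)
    (g : Set (Transition X A × Transition X A)) (π₂ : NetProc X P A) : Prop where
  left : ∃ m₀, IsProcess N m₀ π₁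
  right : ∃ m₀, IsProcess N m₀ π₂
  iso : IsAbstractEventIso τ π₁.net π₂.net g
  rel : Multiset.Rel (Compat g) (toks τ κ π₁ (maxC π₁.net)) (toks τ κ' π₂ (maxC π₂.net))

theorem Linked.swap {N : PTNet P A} {τ : A} {κ κ' : Option P → K} {π₁ π₂ : NetProc X P A}
    {g : Set (Transition X A × Transition X A)} (h : Linked N τ κ κ' π₁ g π₂) :
    Linked N τ κ' κ π₂ (Prod.swap ⁻¹' g) π₁ where
  left := h.right
  right := h.left
  iso := h.iso.swap
  rel := (Multiset.rel_flip.2 h.rel).imp fun _ _ hpq =>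
    ⟨hpq.1.symm, fun x y hxy => (hpq.2 y x hxy).symm⟩

theorem exists_of_map_eq_add {α β : Type*} {f : α → β} {s : Multiset α} {u v : Multiset β}
    (h : s.map f = u + v) : ∃ s₁ s₂, s = s₁ + s₂ ∧ s₁.map f = u ∧ s₂.map f = v := by
  have h' : Multiset.Rel (fun a b => a = f b) (u + v) s :=
    Multiset.rel_map_right.1 (Multiset.rel_eq.2 h.symm)
  obtain ⟨s₁, s₂, h₁, h₂, rfl⟩ := Multiset.rel_add_left.1 h'
  exact ⟨s₁, s₂, rfl, (Multiset.rel_eq.1 (Multiset.rel_map_right.2 h₁)).symm,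
    (Multiset.rel_eq.1 (Multiset.rel_map_right.2 h₂)).symm⟩

theorem Compat.exists_past_iff {g : Set (Transition X A × Transition X A)} {τ : A}
    {κ κ' : Option P → K} {π₁ π₂ : NetProc X P A} {p q : Multiset X}
    (h : Multiset.Rel (Compat g) (p.map (tok τ κ π₁)) (q.map (tok τ κ' π₂)))
    {x y : Transition X A} (hxy : (x, y) ∈ g) :
    (∃ b ∈ p, x ∈ past τ π₁.net b) ↔ ∃ b ∈ q, y ∈ past τ π₂.net b := by
  rw [Multiset.rel_map] at h
  constructor
  · rintro ⟨b, hb, hx⟩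
    obtain ⟨c, hc, hbc⟩ := Multiset.exists_mem_of_rel_of_mem h hb
    exact ⟨c, hc, (hbc.2 x y hxy).1 hx⟩
  · rintro ⟨c, hc, hy⟩
    obtain ⟨b, hb, hbc⟩ := Multiset.exists_mem_of_rel_of_mem (Multiset.rel_flip.2 h) hc
    exact ⟨b, hb, (hbc.2 x y hxy).2 hy⟩

/-- The matching of maximal conditions selects the partners of the conditions consumed by `e₁`;
`hans` tells how these answer, and the other matched conditions stay put. -/
theorem Linked.simulate [Infinite X] {N : PTNet P A} {τ : A} {κ κ' : Option P → K}
    (h0 : κ none = κ' none)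
    (hans : ∀ t ∈ N.trans, ∀ r, Multiset.Rel (fun a x => κ (some a) = κ' x) t.pre r →
      Answer N τ κ κ' t r)
    {π₁ π₂ : NetProc X P A} {g : Set (Transition X A × Transition X A)}
    (h : Linked N τ κ κ' π₁ g π₂) {e₁ : Transition X A} {π₁' : NetProc X P A}
    (hm : ProcMove N π₁ e₁ π₁') :
    (e₁.label = τ ∧ Linked N τ κ κ' π₁' g π₂) ∨
      ∃ σ e₂ π₂' π₂'', obs τ σ = [] ∧ ProcMoves N π₂ σ π₂' ∧ ProcMove N π₂' e₂ π₂'' ∧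
        e₁.label = e₂.label ∧ Linked N τ κ κ' π₁ g π₂' ∧
        Linked N τ κ κ' π₁' (if e₁.label = τ then g else g ∪ {(e₁, e₂)}) π₂'' := by
  obtain ⟨t, ht, het, hlt⟩ := hm.exists_trans
  have hpre := hm.map_pre het
  have hle := hm.2.1.pre_le
  have hπ₁' : ∃ m₀, IsProcess N m₀ π₁' := by obtain ⟨m₀, -, h⟩ := hm.1; exact ⟨m₀, h⟩
  set p := e₁.pre with hp
  set rest := maxC π₁.net - p with hrest
  have hmax₁ : maxC π₁.net = p + rest := (add_tsub_cancel_of_le hle).symm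
  have hrel := h.rel
  rw [hmax₁, toks_add, Multiset.rel_add_left] at hrel
  obtain ⟨Q, Q', hQ, hQ', hsum⟩ := hrel
  -- `q` are the partners of the consumed conditions, `q₀` those of the unconsumed ones.
  obtain ⟨q, q₀, hqq, rfl, rfl⟩ := exists_of_map_eq_add hsum
  have hlive : ∀ b ∈ q, κ' (π₂.onPlaces b) ≠ κ' none := fun b hb => by
    have : b ∈ q + q₀ := Multiset.mem_add.2 (Or.inl hb)
    rw [← hqq] at this
    exact (Multiset.mem_filter.1 this).2
  have hqle : q ≤ maxC π₂.net :=
    (Multiset.le_add_right q q₀).trans (hqq ▸ Multiset.filter_le _ _)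
  obtain ⟨s, hs⟩ := Multiset.le_iff_exists_add.1 hqle
  have htq : toks τ κ' π₂ q = q.map (tok τ κ' π₂) := by
    rw [toks, Multiset.filter_eq_self.2 hlive]
  have hts : toks τ κ' π₂ s = q₀.map (tok τ κ' π₂) := by
    have h1 : toks τ κ' π₂ (q + s) = q.map (tok τ κ' π₂) + q₀.map (tok τ κ' π₂) := by
      rw [← hs]; exact hsum
    rw [toks_add, htq] at h1
    exact add_left_cancel h1
  let live : X → Prop := fun b => κ (π₁.onPlaces b) ≠ κ none
  have hpsplit : p = p.filter live + p.filter fun b => ¬ live b :=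
    (Multiset.filter_add_not live p).symm
  -- Consumed conditions with the colour of $\theta$ are unmatched; $\theta$ itself serves as their
  -- partner.
  have hlink : Multiset.Rel (fun b x => κ (π₁.onPlaces b) = κ' x) p
      (q.map π₂.onPlaces + (p.filter fun b => ¬ live b).map fun _ => none) := by
    conv_lhs => rw [hpsplit]
    refine Multiset.Rel.add ?_ ?_
    · exact Multiset.rel_map_right.2 ((Multiset.rel_map.1 hQ).imp fun b c hbc => hbc.1)
    · refine Multiset.rel_map_right.2 (Multiset.rel_refl_of_refl_on fun b hb => ?_)
      rw [← h0]
      exact not_not.1 (Multiset.mem_filter.1 hb).2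
  have hlink' : Multiset.Rel (fun a x => κ (some a) = κ' x) t.pre
      (q.map π₂.onPlaces + (p.filter fun b => ¬ live b).map fun _ => none) := by
    have h1 := (Multiset.rel_map_left (r := fun (y x : Option P) => κ y = κ' x)).2 hlink
    rw [hpre] at h1
    exact Multiset.rel_map_left.1 h1
  rcases hans t ht _ hlink' with ⟨hτ, hcard, hcol⟩ | ⟨t₂, ht₂, hlab, hcol, hpath⟩
  · left
    refine ⟨hlt.trans hτ, hπ₁', h.right, h.iso.silent_left hm.2.1 (hlt.trans hτ), ?_⟩
    have h1 : toks τ κ π₁' (maxC π₁'.net) = toks τ κ π₁ (maxC π₁.net) := by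
      rw [hm.toks_maxC τ κ het, hmax₁, toks_add, ← hp, add_tsub_cancel_left, add_comm, hcol]
      congr 1
      refine (toks_eq_colours hpre fun b hb => ?_).symm
      -- With only one condition consumed, the produced ones have exactly its past, so the matching
      -- carries over unchanged.
      have hpc : p.card = 1 := by
        rw [← hcard, ← Multiset.card_map π₁.onPlaces p, hpre, Multiset.card_map]
      obtain ⟨c, hc⟩ := Multiset.card_eq_one.1 hpc
      rw [hc, Multiset.mem_singleton] at hb
      subst hb
      ext d
      simp [pastAfter, hc, hlt, hτ]
    rw [h1]
    exact h.rel
  · right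
    obtain ⟨w, w', hw, hw', hww⟩ := Multiset.rel_add_left.1 hpath
    -- Every partner follows a path starting at a place, so none of them is $\theta$.
    have hdead : p.filter (fun b => ¬ live b) = 0 := by
      rw [Multiset.eq_zero_iff_forall_notMem]
      intro b hb
      obtain ⟨c, -, z, hz, -⟩ := Multiset.exists_mem_of_rel_of_mem (Multiset.rel_map_left.1 hw') hb
      cases hz
    have hww' : t₂.pre = w := by
      rw [hdead, Multiset.map_zero, Multiset.rel_zero_left] at hw'
      rw [hww, hw', add_zero]
    have hplive : p.filter live = p := by
      rw [hdead, add_zero] at hpsplit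
      exact hpsplit.symm
    obtain ⟨π₂', q', G, hext, hmax₂, hq', htok, hG⟩ :=
      exists_silentExt_of_rel h.right hs (Multiset.rel_map_left.1 hw)
    have hsp : ∀ b ∈ s, b ∈ π₂.net.places := fun b hb =>
      mem_places_of_le_maxC (s := s) (hs ▸ Multiset.le_add_left s q) hb
    have hts' : toks τ κ' π₂' (s + G) = q₀.map (tok τ κ' π₂) := by
      rw [toks_add, toks_eq_zero hG, add_zero, ← hts]
      exact toks_congr (Multiset.map_congr rfl fun b hb => hext.tok_eq b (hsp b hb))
    have htoks : toks τ κ' π₂' (maxC π₂'.net) = toks τ κ' π₂ (maxC π₂.net) := by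
      rw [hmax₂, toks_add, hts', hs, toks_add, hts, toks_congr htok]
    obtain ⟨m₂, hπ₂'⟩ := hext.preserves h.right
    obtain ⟨e₂, π₂'', hm₂, he₂, het₂⟩ := hπ₂'.exists_procMove (s := q') (t := t₂)
      (by rw [hmax₂]; exact Multiset.le_add_right _ _) ht₂ (by rw [hq', hww'])
    obtain ⟨m₃, -, hπ₂''⟩ := hm₂.1
    have hl : e₁.label = e₂.label := by rw [hlt, hlab, hπ₂''.label_eq e₂ t₂ het₂]
    obtain ⟨σ, hσ, hmoves⟩ := hext.moves
    have hlinked : Linked N τ κ κ' π₁ g π₂' :=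
      ⟨h.left, ⟨m₂, hπ₂'⟩, hext.iso _ _ h.iso, by rw [htoks]; exact h.rel⟩
    have hpq : Multiset.Rel (Compat g) (p.map (tok τ κ π₁)) (q'.map (tok τ κ' π₂')) := by
      rw [htok]
      rw [toks] at hQ
      change Multiset.Rel _ ((p.filter live).map _) _ at hQ
      rwa [hplive] at hQ
    have hpast := fun x y hxy => Compat.exists_past_iff hpq (x := x) (y := y) hxy
    refine ⟨σ, e₂, π₂', π₂'', hσ, hmoves, hm₂, hl, hlinked, hπ₁', ⟨m₃, hπ₂''⟩, ?_, ?_⟩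
    · split_ifs with hτ
      · exact (hlinked.iso.silent_left hm.2.1 hτ).silent_right hm₂.2.1 (hl ▸ hτ)
      · exact hlinked.iso.insert hm.2.1 hm₂.2.1 hl hτ (by rw [he₂]; exact hpast)
    · have hg : ∀ x y, (x, y) ∈ (if e₁.label = τ then g else g ∪ {(e₁, e₂)}) →
          (x, y) ∈ g ∨ (x = e₁ ∧ y = e₂ ∧ e₁.label ≠ τ) := by
        intro x y hxy
        split_ifs at hxy with hτ
        · exact Or.inl hxy
        · rcases hxy with hxy | hxy
          · exact Or.inl hxy
          · cases hxy
            exact Or.inr ⟨rfl, rfl, hτ⟩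
      rw [hm.toks_maxC τ κ het, hm₂.toks_maxC τ κ' het₂, he₂, hmax₂, add_tsub_cancel_left, hts',
        hcol, ← hp]
      refine Multiset.Rel.add ?_ ?_
      -- For unconsumed conditions the new pair of events is harmless, since both events are absent
      -- from the old pasts.
      · refine hQ'.mono fun a ha b hb hab => ⟨hab.1, fun x y hxy => ?_⟩
        rcases hg x y hxy with hxy | ⟨rfl, rfl, -⟩
        · exact hab.2 x y hxy
        · rw [← hts'] at hb
          exact iff_of_false (fun hx => hm.2.1.notMem_trans (past_of_mem_toks ha hx))
            fun hx => hm₂.2.1.notMem_trans (past_of_mem_toks hb hx)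
      -- For produced conditions the colours agree by `hcol`; the pasts agree on old pairs by
      -- `hpast`, and both contain the new events if observable.
      · refine Multiset.rel_map.2 (Multiset.rel_refl_of_refl_on fun c _ => ⟨rfl, fun x y hxy => ?_⟩)
        rcases hg x y hxy with hxy | ⟨rfl, rfl, hτ⟩
        · have hs := hlinked.iso.subset hxy
          have h1 : x ≠ e₁ := fun hx => hm.2.1.notMem_trans (hx ▸ hs.1.1)
          have h2 : y ≠ e₂ := fun hx => hm₂.2.1.notMem_trans (hx ▸ hs.2.1)
          have := hpast x y hxy
          simpa [pastAfter, h1, h2] using this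
        · exact iff_of_true (Or.inl ⟨rfl, hτ⟩) (Or.inl ⟨rfl, hl ▸ hτ⟩)

theorem isBranchingFCBisim_linked [Infinite X] {N : PTNet P A} {τ : A} {κ κ' : Option P → K}
    (h0 : κ none = κ' none)
    (hans : ∀ t ∈ N.trans, ∀ r, Multiset.Rel (fun a x => κ (some a) = κ' x) t.pre r →
      Answer N τ κ κ' t r)
    (hans' : ∀ t ∈ N.trans, ∀ r, Multiset.Rel (fun a x => κ' (some a) = κ x) t.pre r →
      Answer N τ κ' κ t r) :
    IsBranchingFCBisim N τ (Linked (X := X) N τ κ κ') where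
  process_left _ _ _ h := h.left
  process_right _ _ _ h := h.right
  iso _ _ _ h := h.iso
  left π₁ g π₂ h e₁ π₁' hm := by
    rcases h.simulate h0 hans hm with ⟨hτ, h1⟩ | ⟨σ, e₂, π₂', π₂'', hσ, h1, h2, hl, h3, h4⟩
    · exact Or.inl ⟨hτ, [], π₂, rfl, ProcMoves.nil _, h, h1⟩
    · exact Or.inr ⟨σ, e₂, π₂', π₂'', _, hσ, h1, h2, fun hτ => ⟨hl ▸ hτ, if_pos hτ⟩,
        fun hτ => ⟨hl, if_neg hτ⟩, h3, h4⟩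
  right π₁ g π₂ h e₂ π₂' hm := by
    rcases h.swap.simulate h0.symm hans' hm with
      ⟨hτ, h1⟩ | ⟨σ, e₁, π₁', π₁'', hσ, h1, h2, hl, h3, h4⟩
    · exact Or.inl ⟨hτ, [], π₁, rfl, ProcMoves.nil _, h, h1.swap⟩
    · refine Or.inr ⟨σ, e₁, π₁', π₁'', _, hσ, h1, h2, fun hτ => ⟨hl ▸ hτ, ?_⟩,
        fun hτ => ⟨hl.symm, ?_⟩, h3.swap, h4.swap⟩
      · rw [if_pos hτ]
        rfl
      · rw [if_neg hτ]
        ext ⟨x, y⟩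
        simp [and_comm]

end Simulation

/-! ### Initial processes and the conclusion -/

section Initial

variable {P A : Type*}

theorem DAdd.forall_mem_left {N : PTNet P A} {τ : A} {R : Option P → Option P → Prop}
    (hR : IsBranchingDPlaceBisim N τ R) {m n : Multiset P} (h : DAdd R m n) :
    ∀ s ∈ m, s ∈ N.places := by
  intro s hs
  rcases h.exists_of_mem s hs with h | ⟨b, -, -, h⟩ <;> exact hR.left_places _ _ h

end Initial

end PetriNet

open PetriNet in
theorem mainTheorem3 {P A X : Type*} [Infinite X] (N : PetriNet.PTNet P A) (τ : A)
    (hτ : τ ∈ N.labels) (m₁ m₂ : Multiset P)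
    (h : PetriNet.BranchingDPlaceBisimilar N τ m₁ m₂) :
    PetriNet.BranchingFCBisimilar X N τ m₁ m₂ := by
  obtain ⟨R₀, hR₀, hm₀⟩ := h
  obtain ⟨R, hR, h0, hm⟩ : ∃ R : Option P → Option P → Prop,
      IsBranchingDPlaceBisim N τ R ∧ R none none ∧ DAdd R m₁ m₂ :=
    ⟨withNone R₀, hR₀.withNone, Or.inr ⟨rfl, rfl⟩, by rwa [dAdd_withNone]⟩
  have h0' := sideColour_none h0 false true
  refine ⟨_, isBranchingFCBisim_linked (X := X) h0' (fun t ht r => hR.answer h0 false ht)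
    (fun t ht r => hR.answer h0 true ht), ?_⟩
  obtain ⟨π₁, hπ₁, ht₁, hi₁⟩ := exists_initial_process (X := X) N (hm.forall_mem_left hR)
  obtain ⟨π₂, hπ₂, ht₂, hi₂⟩ := exists_initial_process (X := X) N (hm.flip.forall_mem_left hR.flip)
  refine ⟨π₁, π₂, ⟨⟨_, hπ₁⟩, ⟨_, hπ₂⟩, ?_, ?_⟩, ht₁, ht₂, hπ₁.initial_eq, hi₁ ▸ hπ₁.initial_eq,
    hπ₂.initial_eq, hi₂ ▸ hπ₂.initial_eq⟩
  · exact ⟨by simp, by simp [obsEvents, ht₁], by simp [obsEvents, ht₂], by simp, by simp⟩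
  -- Without events all pasts are empty, so linking the initial processes amounts to equality of the
  -- colours of `m₁` and `m₂`.
  · have key : ∀ (π : NetProc X P A) (m : Multiset P) (κ : Option P → Quot (SideEdge R)),
        IsProcess N m π → π.net.trans = ∅ → π.net.initial = maxC π.net →
        toks τ κ π (maxC π.net) = (colours κ m).map fun c => (c, ∅) := by
      intro π m κ hπ ht hi
      refine toks_eq_colours ?_ fun b _ => ?_
      · rw [hπ.isSome_of_mem fun b hb => (mem_maxC.1 hb).1, ← hi, hπ.initial_eq]
      · simp [past, obsEvents, ht]
    rw [key π₁ m₁ _ hπ₁ ht₁ hi₁, key π₂ m₂ _ hπ₂ ht₂ hi₂,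
      hm.colours_eq h0' fun x y hxy => sideColour_eq (b := false) hxy]
    exact Multiset.rel_refl_of_refl_on fun p _ => ⟨rfl, by simp⟩
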